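/- **Model.** Graphs are simple, undirected and unweighted, with vertex set $\{1,\dots,V\}$. The value of a cut $(S,\overline S)$ (both sides nonempty) is its number of crossing edges. The input is a sequence of records: one record for each vertex $1,\dots,V$ in this order, then one record for each of the $E$ edges, carrying its two endpoints as keys, in arbitrary order and with arbitrary orientation. Secondary memory is an unlimited sequence of blocks of $B$ cells, whose first cells hold the input; main memory has $M$ cells and is empty at the start. A ($V$-way indexed) *I/O-tree* with parameters $M,B$ is a finite rooted tree with the following kinds of nodes. A comparison node compares a key of a record in a specified main memory cell with a key of a record in a specified main memory cell, and branches on $<,=,>$. An I/O node reads a specified block into $B$ specified distinct main memory cells, or overwrites a specified block with the contents of $B$ specified main memory cells. An indexed I/O node branches $V$ ways on the value of a key of a record in a specified main memory cell (with an extra branch if the cell is empty), and on each branch performs one block transfer specified for that branch. Each leaf carries an answer. The *depth* of the tree is the maximum number of I/O nodes (plain or indexed) on a root-to-leaf path; comparisons are free. The tree computes the min-cut of a $V$-vertex, $E$-edge graph if, on every connected graph with exactly $V$ vertices and $E$ edges and for every listing of its edges, the leaf that is reached gives the minimum value of a cut (value version), or gives one side of a cut of minimum value (cut version). Write $\mathrm{sort}(V)=\frac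 VB\log_{M/B}\frac VB$. **Theorem.** For every $\varepsilon>0$ there are $c>0$ and $V_0$, depending only on $\varepsilon$, such that the following holds for all integers $V\ge V_0$, $E\ge V$, $B\ge 1$, $M\ge 2B$ with $E\le(1-\varepsilon)\binom V2$ and $\log V<B\log\frac MB$: every I/O-tree with parameters $M,B$ that computes the min-cut of a $V$-vertex, $E$-edge graph, in the value version or in the cut version, has depth at least $$c\cdot\frac EV\,\mathrm{sort}(V).$$ -/

import Mathlib

/-! ### Graphs, edge lists and minimum cuts

Graphs are simple, undirected and unweighted, on the vertex set `Fin V` (the labels `1, …, V`). -/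

/-- The list `e` of ordered pairs lists every edge of `G` exactly once, each in an arbitrary
orientation; the order of the list is arbitrary. In particular `G` has exactly `E` edges. -/
def IsEdgeList {V E : ℕ} (G : SimpleGraph (Fin V)) (e : Fin E → Fin V × Fin V) : Prop :=
  Function.Injective (fun i => s((e i).1, (e i).2)) ∧
    Set.range (fun i => s((e i).1, (e i).2)) = G.edgeSet

/-- `S` is one side of a cut: both `S` and its complement are nonempty. -/
def IsCut {V : ℕ} (S : Finset (Fin V)) : Prop :=
  S.Nonempty ∧ Sᶜ.Nonempty

/-- The value of the cut `(S, Sᶜ)`: the number of crossing edges. -/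
noncomputable def cutValue {V : ℕ} (G : SimpleGraph (Fin V)) (S : Finset (Fin V)) : ℕ :=
  {x ∈ G.edgeSet | ∃ u ∈ S, ∃ v ∈ Sᶜ, x = s(u, v)}.ncard

/-- `S` is one side of a cut of minimum value. -/
def IsMinCut {V : ℕ} (G : SimpleGraph (Fin V)) (S : Finset (Fin V)) : Prop :=
  IsCut S ∧ ∀ S' : Finset (Fin V), IsCut S' → cutValue G S ≤ cutValue G S'

/-- `c` is the minimum value of a cut of `G`. -/
def IsMinCutValue {V : ℕ} (G : SimpleGraph (Fin V)) (c : ℕ) : Prop :=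
  ∃ S : Finset (Fin V), IsMinCut G S ∧ cutValue G S = c

/-! ### The external memory and `P`-way indexed I/O-trees -/

/-- A record carries two keys in a range of size `P`: the endpoints of an edge. A record that
stands for a single vertex carries the same key twice. -/
abbrev Rec (P : ℕ) : Type := Fin 2 → Fin P

/-- The contents of the memories: a main memory of `M` cells and a secondary memory that is an
unlimited sequence of blocks of `B` cells. A cell holds one record or is empty (`none`). -/
structure MemState (P M B : ℕ) : Type where
  mem : Fin M → Option (Rec P)
  disk : ℕ → Fin B → Option (Rec P)

/-- One block transfer. -/
inductive Transfer (M B : ℕ) : Type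
  /-- copy the `B` cells of block `t` to the `B` distinct main memory cells `dst` -/
  | read (t : ℕ) (dst : Fin B ↪ Fin M) : Transfer M B
  /-- overwrite block `t` with the contents of the main memory cells `src` -/
  | write (t : ℕ) (src : Fin B → Fin M) : Transfer M B

open Classical in
/-- The effect of one block transfer. -/
noncomputable def Transfer.exec {P M B : ℕ} : Transfer M B → MemState P M B → MemState P M B
  | .read t dst, σ =>
      { mem := fun i => if h : ∃ b, dst b = i then σ.disk t h.choose else σ.mem i
        disk := σ.disk }
  | .write t src, σ =>
      { mem := σ.mem
        disk := Function.update σ.disk t (fun b => σ.mem (src b)) }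

/-- The key number `s` of the record in main memory cell `i`; `none` if the cell is empty. -/
def MemState.key {P M B : ℕ} (σ : MemState P M B) (i : Fin M) (s : Fin 2) : Option (Fin P) :=
  (σ.mem i).map (fun r => r s)

/-- Three-way comparison of keys; an empty cell counts as smaller than every key. -/
def compareKeys {P : ℕ} : Option (Fin P) → Option (Fin P) → Ordering
  | none, none => .eq
  | none, some _ => .lt
  | some _, none => .gt
  | some a, some b => cmp a b

/-- `P`-way indexed I/O-trees for a main memory of `M` records and blocks of `B` records, with
leaves labelled by answers in `α`. -/
inductive IOTree (P M B : ℕ) (α : Type) : Type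
  /-- stop and give the answer `a` -/
  | leaf (a : α) : IOTree P M B α
  /-- compare key `s` of the record in main memory cell `i` with key `t` of the record in main
  memory cell `j`, and branch on the outcomes `<`, `=`, `>` -/
  | comparison (i : Fin M) (s : Fin 2) (j : Fin M) (t : Fin 2)
      (next : Ordering → IOTree P M B α) : IOTree P M B α
  /-- an I/O whose block address does not depend on the data at hand -/
  | transfer (op : Transfer M B) (next : IOTree P M B α) : IOTree P M B α
  /-- an indexed I/O: the key `s` of the record in main memory cell `i` selects one of the `P`
  branches, each with its own block transfer (the branch `none` is for an empty cell) -/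
  | indexed (i : Fin M) (s : Fin 2) (op : Option (Fin P) → Transfer M B)
      (next : Option (Fin P) → IOTree P M B α) : IOTree P M B α

/-- The answer that the tree gives when it is started on the memory contents `σ`. -/
noncomputable def IOTree.run {P M B : ℕ} {α : Type} :
    IOTree P M B α → MemState P M B → α
  | .leaf a, _ => a
  | .comparison i s j t next, σ => (next (compareKeys (σ.key i s) (σ.key j t))).run σ
  | .transfer op next, σ => next.run (op.exec σ)
  | .indexed i s op next, σ => (next (σ.key i s)).run ((op (σ.key i s)).exec σ)

/-- The depth of an I/O-tree: the largest number of I/Os (plain or indexed) on a path from the root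
to a leaf. Comparisons are free. -/
def IOTree.depth {P M B : ℕ} {α : Type} : IOTree P M B α → ℕ
  | .leaf _ => 0
  | .comparison _ _ _ _ next => max (next .lt).depth (max (next .eq).depth (next .gt).depth)
  | .transfer _ next => next.depth + 1
  | .indexed _ _ _ next => (Finset.univ.sup fun k => (next k).depth) + 1

/-! ### Computing the minimum cut with an I/O-tree -/

/-- The input sequence of records: the `V` vertices in increasing order, then the `E` edges in the
order of the list; empty cells afterwards. -/
def inputRecord {V E : ℕ} (e : Fin E → Fin V × Fin V) (n : ℕ) : Option (Rec V) :=
  if h : n < V then some (fun _ => ⟨n, h⟩)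
  else if h' : n - V < E then some ![(e ⟨n - V, h'⟩).1, (e ⟨n - V, h'⟩).2]
  else none

/-- At the start the input lies contiguously in secondary memory, and main memory is empty. -/
def initialState {V E : ℕ} (M B : ℕ) (e : Fin E → Fin V × Fin V) : MemState V M B where
  mem := fun _ => none
  disk := fun t b => inputRecord e (t * B + b)

/-- The tree gives the minimum cut value of every connected graph with `V` vertices and `E` edges,
however the edges are listed. -/
def ComputesMinCutValue {V M B : ℕ} (E : ℕ) (T : IOTree V M B ℕ) : Prop :=
  ∀ (G : SimpleGraph (Fin V)) (e : Fin E → Fin V × Fin V), G.Connected → IsEdgeList G e →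
    IsMinCutValue G (T.run (initialState M B e))

/-- The tree gives a cut of minimum value of every connected graph with `V` vertices and `E` edges,
however the edges are listed. -/
def ComputesMinCut {V M B : ℕ} (E : ℕ) (T : IOTree V M B (Finset (Fin V))) : Prop :=
  ∀ (G : SimpleGraph (Fin V)) (e : Fin E → Fin V × Fin V), G.Connected → IsEdgeList G e →
    IsMinCut G (T.run (initialState M B e))

/-- `sort(n) = (n / B) log_{M/B} (n / B)`. -/
noncomputable def sortBound (M B n : ℕ) : ℝ :=
  ((n : ℝ) / B) * Real.logb ((M : ℝ) / B) ((n : ℝ) / B)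

/-!
Why the bound holds. The input is a list of edges of which `N`, a constant fraction, have one fixed
endpoint and one endpoint that is not known in advance and ranges over the even labels below `2 * n`,
where `n` is a constant fraction of `V`. The choices of these endpoints form a family with
`n ^ N` members up to a factor `exp (O(N))`.

*What a tree can learn.* Along a path of the tree, everything that influences the run is the order type
of the keys in main memory and the key values used by indexed nodes. One transfer reveals how the
`2 * B` keys of a block interleave with the `2 * M` keys in memory, for which there are at most
`(4 * M + 2 * B).choose (2 * B)` possibilities; an indexed node has `V + 1` branches, which is no more
than `(M / B) ^ B` up to a constant in the exponent, by the assumption on `log V`. The order type inside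
an input block is revealed only once, and all blocks together account for at most `(5 * B) ^ N`
possibilities (`card_le_of_tree`, `card_le_of_good`). So a shallow tree leaves many inputs that it does
not tell apart.

*Mixing two inputs.* Let the inputs `x` and `y` be indistinguishable, and move some of the even labels
of `x` by one step towards the corresponding labels of `y`. Every relation between keys that `x` and `y`
have in common persists, since distinct even labels are two apart, and a fixed label that lies on the
same side of both endpoints is not passed by the step (`Interpolates.isMix`). Hence the tree gives the
same answer on the mixture `z` as on `x`.

*The graphs.* They are chosen so that `x` and its mixtures have no common correct answer. When
`E ≥ 3 * V`, the graph of `x` consists of two 2-edge-connected parts, one of them containing the even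
labels and the other one the odd labels, joined by a bridge. The bridge is the only minimum cut.
Moving at least two unknown edges to odd labels makes the cut between the parts larger than a cut at
some vertex of degree two (`no_common_answer_of_bridge`). At least two labels can be moved up, in one
of the two directions, if `x` and `y` differ in at least three places. When `E < 3 * V`, the graph of
`x` contains a Hamiltonian cycle that alternates between fixed paths and unknown edges, so that every
cut has at least two edges, and moving one unknown edge creates a vertex of degree one
(`no_common_answer_of_hamCycle`).

*The estimate.* With `D` the depth, this gives `n ^ N ≤ exp (O(N + D * B * log (M / B))) * B ^ N`, which is
the claim when `V / B` is large. When `V / B` is bounded, paying for the order types of only those blocks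
that are read gives that a constant fraction of the input has to be read, which suffices then
(`depth_bound_of_log_bounds`).
-/

/-! ### Order types and the number of ways to interleave -/

/-- The families `f` and `g` of keys have the same order type. -/
def SameOrder {κ : Type*} (f g : κ → ℕ) : Prop :=
  ∀ a b, f a < f b ↔ g a < g b

theorem SameOrder.eq_iff {κ : Type*} {f g : κ → ℕ} (h : SameOrder f g) (a b : κ) :
    f a = f b ↔ g a = g b := by
  have h1 := h a b
  have h2 := h b a
  omega

/-- The position of the value `v` relative to the family `f`: the number of members below `v` plus
the number of members at most `v`. Counting both kinds separates the values between two
consecutive members from the members themselves. -/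
def slot {κ : Type*} [Fintype κ] (f : κ → ℕ) (v : ℕ) : ℕ :=
  (Finset.univ.filter fun k => f k < v).card + (Finset.univ.filter fun k => f k ≤ v).card

theorem slot_le {κ : Type*} [Fintype κ] (f : κ → ℕ) (v : ℕ) : slot f v ≤ 2 * Fintype.card κ := by
  have h1 : (Finset.univ.filter fun k => f k < v).card ≤ Fintype.card κ := Finset.card_le_univ _
  have h2 : (Finset.univ.filter fun k => f k ≤ v).card ≤ Fintype.card κ := Finset.card_le_univ _
  unfold slot
  omega

theorem slot_mono {κ : Type*} [Fintype κ] (f : κ → ℕ) : Monotone (slot f) := fun v w h =>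
  add_le_add
    (Finset.card_le_card fun k hk => by
      simp only [Finset.mem_filter, Finset.mem_univ, true_and] at hk ⊢; omega)
    (Finset.card_le_card fun k hk => by
      simp only [Finset.mem_filter, Finset.mem_univ, true_and] at hk ⊢; omega)

theorem slot_lt_of_imp {κ : Type*} [Fintype κ] {f g : κ → ℕ} {v w : ℕ} {c : κ}
    (hlt : ∀ k, f k < v → g k < w) (hle : ∀ k, f k ≤ v → g k ≤ w)
    (hc : (¬ f c < v ∧ g c < w) ∨ (¬ f c ≤ v ∧ g c ≤ w)) : slot f v < slot g w := by
  have s1 : (Finset.univ.filter fun k => f k < v) ⊆ Finset.univ.filter fun k => g k < w :=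
    fun k hk => by simp only [Finset.mem_filter, Finset.mem_univ, true_and] at hk ⊢; exact hlt k hk
  have s2 : (Finset.univ.filter fun k => f k ≤ v) ⊆ Finset.univ.filter fun k => g k ≤ w :=
    fun k hk => by simp only [Finset.mem_filter, Finset.mem_univ, true_and] at hk ⊢; exact hle k hk
  rcases hc with hc | hc
  · refine add_lt_add_of_lt_of_le (Finset.card_lt_card ⟨s1, fun hs => ?_⟩) (Finset.card_le_card s2)
    exact hc.1 (by simpa using hs (by simpa using hc.2 : c ∈ _))
  · refine add_lt_add_of_le_of_lt (Finset.card_le_card s1) (Finset.card_lt_card ⟨s2, fun hs => ?_⟩)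
    exact hc.1 (by simpa using hs (by simpa using hc.2 : c ∈ _))

/-- For families of the same order type, the slot of a value determines how it compares with every
member. -/
theorem lt_iff_of_slot_eq {κ : Type*} [Fintype κ] {f g : κ → ℕ} (h : SameOrder f g) {v w : ℕ}
    (hs : slot f v = slot g w) (k : κ) : (f k < v ↔ g k < w) ∧ (v < f k ↔ w < g k) := by
  have key : ∀ {f g : κ → ℕ}, SameOrder f g → ∀ {v w : ℕ}, slot f v = slot g w →
      (f k < v → g k < w) ∧ (v < f k → w < g k) := by
    intro f g h v w hs
    constructor
    · intro h1
      by_contra h2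
      refine absurd hs (ne_of_gt (slot_lt_of_imp (c := k) (fun a ha => ?_) (fun a ha => ?_) ?_))
      · have := h a k; omega
      · by_contra h3
        have := h k a; have := h a k
        have h4 : g a = g k ∨ g k < g a ∨ g a < g k := by omega
        omega
      · have := h k k; omega
    · intro h1
      by_contra h2
      refine absurd hs (ne_of_lt (slot_lt_of_imp (c := k) (fun a ha => ?_) (fun a ha => ?_) ?_))
      · have := h a k; omega
      · have := h a k; omega
      · omega
  exact ⟨⟨(key h hs).1, (key (fun a b => (h a b).symm) hs.symm).1⟩,
    ⟨(key h hs).2, (key (fun a b => (h a b).symm) hs.symm).2⟩⟩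

/-- If two families agree outside `U`, and each member in `U` has the same slot in both, then they
have the same order type. -/
theorem sameOrder_of_slot_eq {κ : Type*} [Fintype κ] {f g : κ → ℕ} (U : Finset κ)
    (hU : ∀ u ∈ U, slot f (f u) = slot g (g u)) (hc : ∀ c, c ∉ U → f c = g c) : SameOrder f g := by
  -- the slots of members are strictly increasing in the members
  have strict : ∀ (f : κ → ℕ) (a b : κ), f a < f b ↔ slot f (f a) < slot f (f b) := by
    intro f a b
    constructor
    · intro hab
      exact slot_lt_of_imp (c := a) (fun k _ => by omega) (fun k _ => by omega) (by omega)
    · intro hs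
      by_contra hab
      exact absurd (slot_mono f (not_lt.1 hab)) (by omega)
  have key : ∀ {f g : κ → ℕ}, (∀ u ∈ U, slot f (f u) = slot g (g u)) → (∀ c, c ∉ U → f c = g c) →
      ∀ u ∈ U, ∀ c, c ∉ U → (f c < f u → g c < g u) ∧ (f u < f c → g u < g c) := by
    intro f g hU hc u hu c hcU
    have hcc := hc c hcU
    have both : ∀ k ∈ U, (f k < f u ↔ g k < g u) ∧ (f u < f k ↔ g u < g k) := fun k hk => by
      rw [strict f, strict g, strict f, strict g, hU k hk, hU u hu]; exact ⟨Iff.rfl, Iff.rfl⟩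
    constructor
    · intro h1
      by_contra h2
      refine absurd (hU u hu) (ne_of_gt (slot_lt_of_imp (c := c) (fun a ha => ?_)
        (fun a ha => ?_) ?_))
      · by_cases haU : a ∈ U
        · have := both a haU; omega
        · have := hc a haU; omega
      · by_cases haU : a ∈ U
        · have := both a haU; omega
        · have := hc a haU; omega
      · omega
    · intro h1
      by_contra h2
      refine absurd (hU u hu) (ne_of_lt (slot_lt_of_imp (c := c) (fun a ha => ?_)
        (fun a ha => ?_) ?_))
      · by_cases haU : a ∈ U
        · have := both a haU; omega
        · have := hc a haU; omega
      · by_cases haU : a ∈ U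
        · have := both a haU; omega
        · have := hc a haU; omega
      · omega
  have k1 := key hU hc
  have k2 := key (fun u hu => (hU u hu).symm) (fun c hcU => (hc c hcU).symm)
  intro a b
  by_cases ha : a ∈ U <;> by_cases hb : b ∈ U
  · rw [strict f, strict g, hU a ha, hU b hb]
  · exact ⟨(k1 a ha b hb).2, (k2 a ha b hb).2⟩
  · exact ⟨(k1 b hb a ha).1, (k2 b hb a ha).1⟩
  · rw [hc a ha, hc b hb]

/-- There are at most `(K + k).choose k` functions into `{0, …, K}` that are monotone with respect to
a given preorder on `k` elements, here the common order type of the families `f x`. -/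
theorem card_image_le_choose {ι κ : Type*} [Fintype κ] [DecidableEq κ] (X : Finset ι)
    (f g : ι → κ → ℕ) (K : ℕ) (hf : ∀ x ∈ X, ∀ y ∈ X, SameOrder (f x) (f y))
    (hg : ∀ x ∈ X, ∀ a b, f x a ≤ f x b → g x a ≤ g x b) (hK : ∀ x ∈ X, ∀ a, g x a ≤ K) :
    (X.image g).card ≤ (K + Fintype.card κ).choose (Fintype.card κ) := by
  rcases X.eq_empty_or_nonempty with rfl | ⟨x₀, hx₀⟩
  · simp
  let e₀ := (Fintype.equivFin κ).symm
  let e : Fin (Fintype.card κ) ≃ κ := (Tuple.sort (f x₀ ∘ e₀)).trans e₀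
  have he : Monotone (f x₀ ∘ e) := Tuple.monotone_sort (f x₀ ∘ e₀)
  have hmono : ∀ x ∈ X, Monotone (g x ∘ e) := fun x hx i j hij => by
    refine hg x hx _ _ ?_
    have h1 : f x₀ (e i) ≤ f x₀ (e j) := he hij
    have h2 := hf x₀ hx₀ x hx (e j) (e i)
    omega
  -- adding `i` to the `i`-th value makes the functions strictly increasing, hence determined by
  -- their ranges
  let G : (κ → ℕ) → Fin (Fintype.card κ) → ℕ := fun h i => h (e i) + i
  have hG : ∀ h ∈ X.image g, StrictMono (G h) := by
    intro h hh
    obtain ⟨x, hx, rfl⟩ := Finset.mem_image.1 hh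
    exact (hmono x hx).add_strictMono Fin.val_strictMono
  rw [← Finset.card_range (K + Fintype.card κ), ← Finset.card_powersetCard]
  refine Finset.card_le_card_of_injOn (fun h => Finset.univ.image (G h)) ?_ ?_
  · intro h hh
    obtain ⟨x, hx, hxh⟩ := Finset.mem_image.1 hh
    rw [Finset.mem_coe, Finset.mem_powersetCard]
    refine ⟨fun v hv => ?_, ?_⟩
    · obtain ⟨i, -, rfl⟩ := Finset.mem_image.1 hv
      have := hK x hx (e i)
      have := i.2
      simp only [Finset.mem_range, G, ← hxh]
      omega
    · rw [Finset.card_image_of_injective _ (hG h hh).injective, Finset.card_univ, Fintype.card_fin]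
  · intro h hh h' hh' heq
    have h1 : Set.range (G h) = Set.range (G h') := by
      have := congrArg (fun s : Finset ℕ => (s : Set ℕ)) heq
      simpa using this
    have h2 := (StrictMono.range_inj (hG h hh) (hG h' hh')).1 h1
    funext a
    have h3 := congrFun h2 (e.symm a)
    simpa [G] using h3

/-- If `g` takes at most `c` values on `X`, and at most `m` elements of `X` share a value, then `X`
has at most `c * m` elements. -/
theorem card_le_mul_of_fiber_le {ι γ : Type*} [DecidableEq γ] (X : Finset ι) (g : ι → γ) (c m : ℕ)
    (hc : (X.image g).card ≤ c) (hm : ∀ x ∈ X, (X.filter fun y => g y = g x).card ≤ m) :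
    X.card ≤ c * m := by
  refine (Finset.card_le_mul_card_image (f := g) X m fun b hb => ?_).trans ?_
  · obtain ⟨x, hx, rfl⟩ := Finset.mem_image.1 hb
    exact hm x hx
  · rw [mul_comm]
    exact Nat.mul_le_mul_right m hc

/-! ### Mixing inputs -/

/-- The family `z` is an order-preserving mixture of `x` and `y`: relations between members, and
values of members, that `x` and `y` have in common also hold for `z`. -/
structure IsMix {κ : Type*} (x y z : κ → ℕ) : Prop where
  lt : ∀ a b, x a < x b → y a < y b → z a < z b
  eq : ∀ a b, x a = x b → y a = y b → z a = z b
  const : ∀ a, x a = y a → z a = x a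

/-- An optional key as a natural number, the empty key being the smallest one. -/
def optRank {P : ℕ} : Option (Fin P) → ℕ
  | none => 0
  | some a => a + 1

theorem optRank_injective {P : ℕ} : Function.Injective (optRank (P := P)) := by
  rintro (_ | a) (_ | b) h
  · rfl
  · simp [optRank] at h
  · simp [optRank] at h
  · simp only [optRank, add_left_inj] at h
    rw [Fin.ext h]

theorem compareKeys_eq_cmp {P : ℕ} (a b : Option (Fin P)) :
    compareKeys a b = cmp (optRank a) (optRank b) := by
  rcases a with _ | a <;> rcases b with _ | b
  · rfl
  · exact ((cmp_eq_lt_iff _ _).2 (Nat.succ_pos _)).symm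
  · exact ((cmp_eq_gt_iff _ _).2 (Nat.succ_pos _)).symm
  · simp only [compareKeys, optRank]
    rcases lt_trichotomy a b with h | h | h
    · rw [(cmp_eq_lt_iff _ _).2 h, (cmp_eq_lt_iff _ _).2 (by have := Fin.lt_def.1 h; omega)]
    · rw [(cmp_eq_eq_iff _ _).2 h, (cmp_eq_eq_iff _ _).2 (by rw [h])]
    · rw [(cmp_eq_gt_iff _ _).2 h, (cmp_eq_gt_iff _ _).2 (by have := Fin.lt_def.1 h; omega)]

/-- Key number `a.2` of the record at place `a.1` of the input sequence `v`, as a natural number. -/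
def inputKey {P : ℕ} (v : ℕ → Option (Rec P)) (a : ℕ × Fin 2) : ℕ :=
  optRank ((v a.1).map fun r => r a.2)

/-! ### Symbolic memory contents -/

/-- The contents of the memories in terms of the input: each cell holds the record that stood at a
certain place of the input sequence. -/
structure SymState (M B : ℕ) : Type where
  mem : Fin M → ℕ
  disk : ℕ → Fin B → ℕ

namespace SymState

variable {P M B : ℕ}

/-- The actual contents of the memories on the input sequence `v`. -/
def concrete (S : SymState M B) (v : ℕ → Option (Rec P)) : MemState P M B where
  mem i := v (S.mem i)
  disk t b := v (S.disk t b)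

open Classical in
/-- The effect of a block transfer, which does not depend on the input. -/
noncomputable def exec (op : Transfer M B) (S : SymState M B) : SymState M B :=
  match op with
  | .read t dst =>
      { mem := fun i => if h : ∃ b, dst b = i then S.disk t h.choose else S.mem i
        disk := S.disk }
  | .write t src =>
      { mem := S.mem
        disk := Function.update S.disk t fun b => S.mem (src b) }

theorem exec_concrete (op : Transfer M B) (S : SymState M B) (v : ℕ → Option (Rec P)) :
    op.exec (S.concrete v) = (S.exec op).concrete v := by
  cases op with
  | read t dst =>
    simp only [Transfer.exec, concrete, exec, MemState.mk.injEq, and_true]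
    funext i
    split_ifs <;> rfl
  | write t src =>
    simp only [Transfer.exec, concrete, exec, MemState.mk.injEq, true_and]
    funext t' b
    by_cases h : t' = t
    · subst h; simp
    · simp [Function.update_of_ne h]

/-- The keys in main memory on the input sequence `v`. -/
def memKeys (S : SymState M B) (v : ℕ → Option (Rec P)) (a : Fin M × Fin 2) : ℕ :=
  inputKey v (S.mem a.1, a.2)

/-- The keys in block `t` on the input sequence `v`. -/
def blockKeys (S : SymState M B) (t : ℕ) (v : ℕ → Option (Rec P)) (a : Fin B × Fin 2) : ℕ :=
  inputKey v (S.disk t a.1, a.2)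

theorem optRank_key (S : SymState M B) (v : ℕ → Option (Rec P)) (i : Fin M) (s : Fin 2) :
    optRank ((S.concrete v).key i s) = S.memKeys v (i, s) := rfl

end SymState

/-- The inputs in `X` are indistinguishable by the order types of the keys in main memory and in each
block that is not fresh. A fresh block `t ∈ Fr` has at most `j t` keys that vary over `X`. -/
structure Known {ι : Type*} {P M B : ℕ} (w : ι → ℕ → Option (Rec P)) (j : ℕ → ℕ)
    (S : SymState M B) (Fr : Finset ℕ) (X : Finset ι) : Prop where
  mem : ∀ x ∈ X, ∀ y ∈ X, SameOrder (S.memKeys (w x)) (S.memKeys (w y))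
  disk : ∀ t, t ∉ Fr → ∀ x ∈ X, ∀ y ∈ X, SameOrder (S.blockKeys t (w x)) (S.blockKeys t (w y))
  fresh : ∀ t ∈ Fr, ∃ U : Finset (Fin B × Fin 2), U.card ≤ j t ∧
    ∀ a, a ∉ U → ∀ x ∈ X, ∀ y ∈ X, S.blockKeys t (w x) a = S.blockKeys t (w y) a

/-! ### The information gained by one block transfer -/

section Counting

variable {ι : Type*} {P M B : ℕ} {w : ι → ℕ → Option (Rec P)} {j pot : ℕ → ℕ} {R : ℕ}

theorem Known.mono {S : SymState M B} {Fr : Finset ℕ} {X Y : Finset ι} (h : Known w j S Fr X)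
    (hYX : Y ⊆ X) : Known w j S Fr Y where
  mem x hx y hy := h.mem x (hYX hx) y (hYX hy)
  disk t ht x hx y hy := h.disk t ht x (hYX hx) y (hYX hy)
  fresh t ht := by
    obtain ⟨U, hU, hc⟩ := h.fresh t ht
    exact ⟨U, hU, fun a ha x hx y hy => hc a ha x (hYX hx) y (hYX hy)⟩

theorem Known.write {S : SymState M B} {Fr : Finset ℕ} {X : Finset ι} (h : Known w j S Fr X)
    (t : ℕ) (src : Fin B → Fin M) : Known w j (S.exec (.write t src)) (Fr.erase t) X where
  mem := h.mem
  disk t' ht' x hx y hy := by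
    by_cases htt : t' = t
    · subst htt
      intro a b
      simpa [SymState.blockKeys, SymState.exec, SymState.memKeys] using
        h.mem x hx y hy (src a.1, a.2) (src b.1, b.2)
    · have h1 : t' ∉ Fr := fun hF => ht' (Finset.mem_erase.2 ⟨htt, hF⟩)
      have h2 : ∀ z, (S.exec (.write t src)).blockKeys t' (w z) = S.blockKeys t' (w z) := fun z => by
        funext a
        simp only [SymState.blockKeys, SymState.exec, Function.update_of_ne htt]
      rw [h2, h2]
      exact h.disk t' h1 x hx y hy
  fresh t' ht' := by
    obtain ⟨htt, hF⟩ := Finset.mem_erase.1 ht'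
    simpa [SymState.blockKeys, SymState.exec, Function.update_of_ne htt] using h.fresh t' hF

/-- The memory after a read consists of old cells and cells of the block, so its order type is
determined by that of the memory, that of the block, and the slots of the block's keys in memory. -/
theorem Known.read {S : SymState M B} {Fr : Finset ℕ} {X : Finset ι} (h : Known w j S Fr X)
    {t : ℕ} (ht : t ∉ Fr) (dst : Fin B ↪ Fin M)
    (hslot : ∀ x ∈ X, ∀ y ∈ X, ∀ a, slot (S.memKeys (w x)) (S.blockKeys t (w x) a) =
      slot (S.memKeys (w y)) (S.blockKeys t (w y) a)) :
    Known w j (S.exec (.read t dst)) Fr X where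
  disk := h.disk
  fresh := h.fresh
  mem x hx y hy := by
    have cell : ∀ a : Fin M × Fin 2,
        (∃ b, ∀ z, (S.exec (.read t dst)).memKeys (w z) a = S.blockKeys t (w z) (b, a.2)) ∨
        (∀ z, (S.exec (.read t dst)).memKeys (w z) a = S.memKeys (w z) a) := by
      intro a
      by_cases hb : ∃ b, dst b = a.1
      · exact Or.inl ⟨hb.choose, fun z => by
          simp only [SymState.memKeys, SymState.exec, dif_pos hb, SymState.blockKeys]⟩
      · exact Or.inr fun z => by simp only [SymState.memKeys, SymState.exec, dif_neg hb]
    have cross := fun b => lt_iff_of_slot_eq (h.mem x hx y hy) (hslot x hx y hy b)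
    intro a b
    rcases cell a with ⟨c, ha⟩ | ha <;> rcases cell b with ⟨d, hb⟩ | hb <;>
      rw [ha, ha, hb, hb]
    · exact h.disk t ht x hx y hy _ _
    · exact (cross _ _).2
    · exact (cross _ _).1
    · exact h.mem x hx y hy _ _

/-- Reading a fresh block of `B` records reveals the order type of its `j t` varying keys, for which
there are at most `(5 * B) ^ j t` possibilities. -/
theorem card_le_of_fresh {S : SymState M B} {Fr : Finset ℕ} {X : Finset ι}
    (hX : Known w j S Fr X) (hB : 1 ≤ B) {t : ℕ} (ht : t ∈ Fr) (m : ℕ)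
    (H : ∀ Y ⊆ X, Known w j S (Fr.erase t) Y → Y.card ≤ m) : X.card ≤ (5 * B) ^ j t * m := by
  classical
  obtain ⟨U, hU, hc⟩ := hX.fresh t ht
  let g : ι → U → Fin (4 * B + 1) := fun x u =>
    ⟨slot (S.blockKeys t (w x)) (S.blockKeys t (w x) u), by
      have := slot_le (S.blockKeys t (w x)) (S.blockKeys t (w x) u)
      simp only [Fintype.card_prod, Fintype.card_fin] at this
      omega⟩
  refine card_le_mul_of_fiber_le X g _ m ?_ fun x hx => H _ (Finset.filter_subset _ _) ?_
  · refine (Finset.card_le_univ _).trans ?_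
    rw [Fintype.card_fun, Fintype.card_fin, Fintype.card_coe]
    calc (4 * B + 1) ^ U.card ≤ (5 * B) ^ U.card := Nat.pow_le_pow_left (by omega) _
      _ ≤ (5 * B) ^ j t := Nat.pow_le_pow_right (by omega) hU
  · have hsub := hX.mono (Finset.filter_subset (fun y => g y = g x) X)
    refine ⟨hsub.mem, fun t' ht' y hy z hz => ?_,
      fun t' ht' => hsub.fresh t' (Finset.mem_of_mem_erase ht')⟩
    by_cases htt : t' = t
    · subst htt
      obtain ⟨hyX, hyx⟩ := Finset.mem_filter.1 hy
      obtain ⟨hzX, hzx⟩ := Finset.mem_filter.1 hz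
      refine sameOrder_of_slot_eq U (fun u hu => ?_) fun a ha => hc a ha y hyX z hzX
      exact congrArg Fin.val (congrFun (hyx.trans hzx.symm) ⟨u, hu⟩)
    · exact hsub.disk t' (fun hF => ht' (Finset.mem_erase.2 ⟨htt, hF⟩)) y hy z hz

/-- Reading a block of known order type reveals how its `2 * B` keys interleave with the `2 * M` keys
in main memory. -/
theorem card_le_of_read {S : SymState M B} {Fr : Finset ℕ} {X : Finset ι}
    (hX : Known w j S Fr X) {t : ℕ} (ht : t ∉ Fr) (dst : Fin B ↪ Fin M) (m : ℕ)
    (H : ∀ Y ⊆ X, Known w j (S.exec (.read t dst)) Fr Y → Y.card ≤ m) :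
    X.card ≤ (4 * M + 2 * B).choose (2 * B) * m := by
  classical
  let g : ι → Fin B × Fin 2 → ℕ := fun x a => slot (S.memKeys (w x)) (S.blockKeys t (w x) a)
  refine card_le_mul_of_fiber_le X g _ m ?_ fun x hx => H _ (Finset.filter_subset _ _) ?_
  · have h1 := card_image_le_choose X (fun x => S.blockKeys t (w x)) g (4 * M) (hX.disk t ht)
      (fun x _ a b hab => slot_mono _ hab) (fun x _ a => ?_)
    · simpa [mul_comm] using h1
    · have := slot_le (S.memKeys (w x)) (S.blockKeys t (w x) a)
      simp only [Fintype.card_prod, Fintype.card_fin] at this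
      simp only [g]
      omega
  · refine (hX.mono (Finset.filter_subset _ _)).read ht dst fun y hy z hz a => ?_
    exact congrFun ((Finset.mem_filter.1 hy).2.trans (Finset.mem_filter.1 hz).2.symm) a

/-- One block transfer splits a set of indistinguishable inputs into a bounded number of such sets.
The cost of a fresh block is shared between the factor `R` of the transfer and the potential of the
block. -/
theorem card_le_of_transfer {S : SymState M B} {Fr : Finset ℕ} {X : Finset ι}
    (hX : Known w j S Fr X) (hB : 1 ≤ B) (hR : 1 ≤ R) (hpot : ∀ t, 1 ≤ pot t)
    (hj : ∀ t, (5 * B) ^ j t ≤ R * pot t) (op : Transfer M B) (m : ℕ)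
    (H : ∀ Y ⊆ X, ∀ Fr' ⊆ Fr, Known w j (S.exec op) Fr' Y → Y.card ≤ m * ∏ t ∈ Fr', pot t) :
    X.card ≤ (4 * M + 2 * B).choose (2 * B) * R * (m * ∏ t ∈ Fr, pot t) := by
  have hC : 1 ≤ (4 * M + 2 * B).choose (2 * B) := Nat.choose_pos (by omega)
  cases op with
  | write t src =>
    have h1 := H X subset_rfl _ (Finset.erase_subset t Fr) (hX.write t src)
    have h2 : ∏ t ∈ Fr.erase t, pot t ≤ ∏ t ∈ Fr, pot t :=
      Finset.prod_le_prod_of_subset_of_one_le' (Finset.erase_subset t Fr) fun i _ _ => hpot i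
    exact (h1.trans (Nat.mul_le_mul_left m h2)).trans (Nat.le_mul_of_pos_left _ (by positivity))
  | read t dst =>
    by_cases ht : t ∈ Fr
    · have h1 := card_le_of_fresh hX hB ht
        ((4 * M + 2 * B).choose (2 * B) * (m * ∏ t ∈ Fr.erase t, pot t))
        fun Y hY hYk => card_le_of_read hYk (Finset.notMem_erase t Fr) dst _ fun Z hZ hZk =>
          H Z (hZ.trans hY) _ (Finset.erase_subset t Fr) hZk
      rw [← Finset.mul_prod_erase Fr pot ht]
      calc X.card ≤ _ := h1
        _ ≤ R * pot t * ((4 * M + 2 * B).choose (2 * B) * (m * ∏ t ∈ Fr.erase t, pot t)) :=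
          Nat.mul_le_mul_right _ (hj t)
        _ = _ := by ring
    · have h1 := card_le_of_read hX ht dst (m * ∏ t ∈ Fr, pot t)
        fun Y hY hYk => H Y hY Fr subset_rfl hYk
      refine h1.trans (Nat.mul_le_mul_right _ ?_)
      exact Nat.le_mul_of_pos_right _ hR

/-- The counting bound for I/O-trees. If every set of inputs on which the tree cannot tell an input
from the mixtures of two of them has at most `q` elements, then the number of inputs is at most
`q` times the number of ways in which the transfers can go. -/
theorem card_le_of_tree {α : Type} (hB : 1 ≤ B) (hR : 1 ≤ R) (hpot : ∀ t, 1 ≤ pot t)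
    (hj : ∀ t, (5 * B) ^ j t ≤ R * pot t) (q : ℕ) (T : IOTree P M B α) :
    ∀ (S : SymState M B) (Fr : Finset ℕ) (X : Finset ι), Known w j S Fr X →
      (∀ A ⊆ X, (∀ x ∈ A, ∀ y ∈ A, ∀ v, IsMix (inputKey (w x)) (inputKey (w y)) (inputKey v) →
        T.run (S.concrete v) = T.run (S.concrete (w x))) → A.card ≤ q) →
      X.card ≤ q * ((P + 1) * ((4 * M + 2 * B).choose (2 * B) * R)) ^ T.depth *
        ∏ t ∈ Fr, pot t := by
  classical
  have hC : 1 ≤ (4 * M + 2 * B).choose (2 * B) := Nat.choose_pos (by omega)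
  have hbase : 1 ≤ (P + 1) * ((4 * M + 2 * B).choose (2 * B) * R) :=
    Nat.mul_pos (Nat.succ_pos P) (Nat.mul_pos hC hR)
  set c := (4 * M + 2 * B).choose (2 * B) * R with hc
  induction T with
  | leaf a =>
    intro S Fr X hX H
    have h1 : X.card ≤ q := H X subset_rfl fun x _ y _ v _ => rfl
    have h2 : 1 ≤ ∏ t ∈ Fr, pot t := Finset.one_le_prod' fun i _ => hpot i
    simpa [IOTree.depth] using h1.trans (Nat.le_mul_of_pos_right q h2)
  | comparison i s i' s' next ih =>
    intro S Fr X hX H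
    rcases X.eq_empty_or_nonempty with rfl | ⟨x₀, hx₀⟩
    · simp
    -- the outcome is the same for all inputs in `X` and for their mixtures
    obtain ⟨o, ho⟩ : ∃ o, ∀ x ∈ X, cmp (S.memKeys (w x) (i, s)) (S.memKeys (w x) (i', s')) = o := by
      refine ⟨cmp (S.memKeys (w x₀) (i, s)) (S.memKeys (w x₀) (i', s')), fun x hx => ?_⟩
      have h1 := hX.mem x hx x₀ hx₀
      rcases lt_trichotomy (S.memKeys (w x) (i, s)) (S.memKeys (w x) (i', s')) with h | h | h
      · rw [(cmp_eq_lt_iff _ _).2 h, (cmp_eq_lt_iff _ _).2 ((h1 _ _).1 h)]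
      · rw [(cmp_eq_eq_iff _ _).2 h, (cmp_eq_eq_iff _ _).2 ((h1.eq_iff _ _).1 h)]
      · rw [(cmp_eq_gt_iff _ _).2 h, (cmp_eq_gt_iff _ _).2 ((h1 _ _).1 h)]
    have hmix : ∀ x ∈ X, ∀ y ∈ X, ∀ v : ℕ → Option (Rec P),
        IsMix (inputKey (w x)) (inputKey (w y)) (inputKey v) →
        cmp (S.memKeys v (i, s)) (S.memKeys v (i', s')) = o := by
      intro x hx y hy v hv
      have h1 := ho x hx
      have h2 := ho y hy
      cases o
      · rw [cmp_eq_lt_iff] at h1 h2 ⊢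
        exact hv.lt _ _ h1 h2
      · rw [cmp_eq_eq_iff] at h1 h2 ⊢
        exact hv.eq _ _ h1 h2
      · rw [cmp_eq_gt_iff] at h1 h2 ⊢
        exact hv.lt _ _ h1 h2
    have h1 := ih o S Fr X hX fun A hA hgood => H A hA fun x hx y hy v hv => by
      simp only [IOTree.run, compareKeys_eq_cmp, SymState.optRank_key]
      rw [hmix x (hA hx) y (hA hy) v hv, ho x (hA hx)]
      exact hgood x hx y hy v hv
    refine h1.trans (Nat.mul_le_mul_right _ (Nat.mul_le_mul_left _ (Nat.pow_le_pow_right hbase ?_)))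
    cases o <;> simp [IOTree.depth]
  | transfer op next ih =>
    intro S Fr X hX H
    have h1 := card_le_of_transfer hX hB hR hpot hj op
      (q * ((P + 1) * c) ^ next.depth) fun Y hY Fr' _ hk =>
        ih (S.exec op) Fr' Y hk fun A hA hgood => H A (hA.trans hY) fun x hx y hy v hv => by
          simp only [IOTree.run, SymState.exec_concrete]
          exact hgood x hx y hy v hv
    rw [← hc] at h1
    calc X.card ≤ _ := h1
      _ ≤ (P + 1) * (c * (q * ((P + 1) * c) ^ next.depth * ∏ t ∈ Fr, pot t)) :=
        Nat.le_mul_of_pos_left _ (Nat.succ_pos P)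
      _ = _ := by rw [IOTree.depth, pow_succ]; ring
  | indexed i s op next ih =>
    intro S Fr X hX H
    set d := Finset.univ.sup fun k => (next k).depth with hd
    have h1 := card_le_mul_of_fiber_le X (fun x => (S.concrete (w x)).key i s) (P + 1)
      (c * (q * ((P + 1) * c) ^ d * ∏ t ∈ Fr, pot t))
      ((Finset.card_le_univ _).trans (by simp)) fun x₀ hx₀ => by
        set k := (S.concrete (w x₀)).key i s with hk
        set Y := X.filter fun x => (S.concrete (w x)).key i s = k with hY
        have hYX : Y ⊆ X := Finset.filter_subset _ _
        have hYk : ∀ x ∈ Y, (S.concrete (w x)).key i s = k := fun x hx =>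
          (Finset.mem_filter.1 hx).2
        have hmix : ∀ x ∈ Y, ∀ y ∈ Y, ∀ v : ℕ → Option (Rec P),
            IsMix (inputKey (w x)) (inputKey (w y)) (inputKey v) →
            (S.concrete v).key i s = k := by
          intro x hx y hy v hv
          apply optRank_injective
          rw [← hYk x hx]
          refine hv.const (S.mem i, s) ?_
          exact congrArg optRank ((hYk x hx).trans (hYk y hy).symm)
        refine card_le_of_transfer (hX.mono hYX) hB hR hpot hj (op k) _ fun Z hZ Fr' _ hZk => ?_
        refine (ih k (S.exec (op k)) Fr' Z hZk fun A hA hgood => H A (hA.trans (hZ.trans hYX))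
          fun x hx y hy v hv => ?_).trans ?_
        · simp only [IOTree.run]
          rw [hmix x (hZ (hA hx)) y (hZ (hA hy)) v hv, hYk x (hZ (hA hx)),
            SymState.exec_concrete, SymState.exec_concrete]
          exact hgood x hx y hy v hv
        · refine Nat.mul_le_mul_right _ (Nat.mul_le_mul_left _ (Nat.pow_le_pow_right hbase ?_))
          exact Finset.le_sup (f := fun k => (next k).depth) (Finset.mem_univ k)
    calc X.card ≤ _ := h1
      _ = _ := by rw [IOTree.depth, ← hd, pow_succ]; ring

end Counting

/-! ### Families of edge lists with unknown endpoints -/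

section Family

variable {V N E M B : ℕ}

/-- The edge list that starts with the `N` edges `(u p, x p)` and continues with the list `k`. -/
def edgeListing (u x : Fin N → Fin V) (k : Fin (E - N) → Fin V × Fin V) (i : Fin E) :
    Fin V × Fin V :=
  if h : i < N then (u ⟨i, h⟩, x ⟨i, h⟩) else k ⟨i - N, by omega⟩

/-- The endpoints `z` arise from the endpoints `x` by moving some labels one step towards the
corresponding labels of `y`; places with the same labels in `x` and in `y` are treated alike. -/
structure Interpolates (x y z : Fin N → Fin V) : Prop where
  step : ∀ p, z p = x p ∨ ((x p : ℕ) < y p ∧ (z p : ℕ) = x p + 1) ∨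
    ((y p : ℕ) < x p ∧ (z p : ℕ) + 1 = x p)
  consistent : ∀ p p', x p = x p' → y p = y p' → z p = z p'

theorem inputKey_edgeListing_unknown (hN : N ≤ E) (u x : Fin N → Fin V)
    (k : Fin (E - N) → Fin V × Fin V) (p : Fin N) :
    inputKey (inputRecord (edgeListing u x k)) (V + p, 1) = x p + 1 := by
  have h1 : ¬ V + (p : ℕ) < V := by omega
  have h2 : (p : ℕ) < E := by omega
  simp [inputKey, inputRecord, edgeListing, h2, optRank]

theorem inputKey_edgeListing_known (u x y : Fin N → Fin V)
    (k : Fin (E - N) → Fin V × Fin V) (n : ℕ) (s : Fin 2) (h : ¬ (V ≤ n ∧ n < V + N ∧ s = 1)) :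
    inputKey (inputRecord (edgeListing u x k)) (n, s) =
      inputKey (inputRecord (edgeListing u y k)) (n, s) := by
  by_cases h1 : n < V
  · simp [inputKey, inputRecord, h1]
  · by_cases h2 : n - V < E
    · by_cases h3 : n - V < N
      · have hs : s = 0 := by
          have : s ≠ 1 := fun hs => h ⟨by omega, by omega, hs⟩
          omega
        subst hs
        simp [inputKey, inputRecord, edgeListing, h1, h2, h3, optRank]
      · simp [inputKey, inputRecord, edgeListing, h1, h2, h3]
    · simp [inputKey, inputRecord, h1, h2]

theorem inputKey_edgeListing_cases (hN : N ≤ E) (u : Fin N → Fin V)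
    (k : Fin (E - N) → Fin V × Fin V) (a : ℕ × Fin 2) :
    (∃ p : Fin N, ∀ x, inputKey (inputRecord (edgeListing u x k)) a = x p + 1) ∨
      ∃ c, ∀ x, inputKey (inputRecord (edgeListing u x k)) a = c := by
  obtain ⟨n, s⟩ := a
  by_cases h : V ≤ n ∧ n < V + N ∧ s = 1
  · obtain ⟨h1, h2, rfl⟩ := h
    refine Or.inl ⟨⟨n - V, by omega⟩, fun x => ?_⟩
    rw [← inputKey_edgeListing_unknown hN u x k]
    congr 2
    simp only
    omega
  · exact Or.inr ⟨inputKey (inputRecord (edgeListing u u k)) (n, s), fun x =>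
      inputKey_edgeListing_known u x u k n s h⟩

/-- Even labels leave room for a step: moving even labels one step towards other even labels
preserves all relations that hold both before and after, also those with fixed labels. -/
theorem Interpolates.isMix {x y z : Fin N → Fin V} (h : Interpolates x y z)
    (hx : ∀ p, (x p : ℕ) % 2 = 0) (hy : ∀ p, (y p : ℕ) % 2 = 0) (hN : N ≤ E) (u : Fin N → Fin V)
    (k : Fin (E - N) → Fin V × Fin V) :
    IsMix (inputKey (inputRecord (edgeListing u x k)))
      (inputKey (inputRecord (edgeListing u y k)))
      (inputKey (inputRecord (edgeListing u z k))) := by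
  have hstep : ∀ p, (z p : ℕ) = x p ∨ ((x p : ℕ) < y p ∧ (z p : ℕ) = x p + 1) ∨
      ((y p : ℕ) < x p ∧ (z p : ℕ) + 1 = x p) := fun p => by
    rcases h.step p with h1 | h1
    · exact Or.inl (congrArg Fin.val h1)
    · exact Or.inr h1
  refine ⟨fun a b hxa hya => ?_, fun a b hxa hya => ?_, fun a ha => ?_⟩
  · rcases inputKey_edgeListing_cases hN u k a with ⟨p, hp⟩ | ⟨c, hp⟩ <;>
    rcases inputKey_edgeListing_cases hN u k b with ⟨p', hp'⟩ | ⟨c', hp'⟩ <;>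
    rw [hp, hp'] at hxa hya ⊢
    · have := hstep p; have := hstep p'; have := hx p; have := hx p'; have := hy p
      have := hy p'
      omega
    · have := hstep p; have := hx p; have := hy p
      omega
    · have := hstep p'; have := hx p'; have := hy p'
      omega
    · exact hxa
  · rcases inputKey_edgeListing_cases hN u k a with ⟨p, hp⟩ | ⟨c, hp⟩ <;>
    rcases inputKey_edgeListing_cases hN u k b with ⟨p', hp'⟩ | ⟨c', hp'⟩ <;>
    rw [hp, hp'] at hxa hya ⊢
    · rw [h.consistent p p' (Fin.ext (by omega)) (Fin.ext (by omega))]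
    · have := hstep p
      omega
    · have := hstep p'
      omega
    · exact hxa
  · rcases inputKey_edgeListing_cases hN u k a with ⟨p, hp⟩ | ⟨c, hp⟩
    · rw [hp, hp] at ha ⊢
      have := hstep p
      omega
    · rw [hp, hp]

/-- The input sequence occupies the secondary memory; main memory consists of empty cells, as on
place `V + E`. -/
def initialSym (V E M B : ℕ) : SymState M B where
  mem _ := V + E
  disk t b := t * B + b

theorem initialState_eq (e : Fin E → Fin V × Fin V) :
    initialState M B e = (initialSym V E M B).concrete (inputRecord e) := by
  simp only [initialState, SymState.concrete, initialSym, MemState.mk.injEq, and_true]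
  funext i
  simp [inputRecord]

/-- The number of cells of block `t` of the input that hold an edge with an unknown endpoint. -/
def unknownInBlock (V N B t : ℕ) : ℕ :=
  (Finset.univ.filter fun b : Fin B => V ≤ t * B + b ∧ t * B + b < V + N).card

theorem unknownInBlock_le (V N B t : ℕ) : unknownInBlock V N B t ≤ B := by
  simpa [unknownInBlock] using Finset.card_le_univ
    (Finset.univ.filter fun b : Fin B => V ≤ t * B + b ∧ t * B + b < V + N)

theorem sum_unknownInBlock_le (V N B : ℕ) (s : Finset ℕ) :
    ∑ t ∈ s, unknownInBlock V N B t ≤ N := by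
  unfold unknownInBlock
  rw [← Finset.card_sigma]
  calc _ ≤ (Finset.Ico V (V + N)).card := by
        refine Finset.card_le_card_of_injOn (fun a => a.1 * B + a.2) ?_ ?_
        · rintro ⟨t, b⟩ h
          simp only [Finset.coe_sigma, Set.mem_sigma_iff, Finset.mem_coe, Finset.mem_filter,
            Finset.mem_univ, true_and] at h
          simpa using h.2
        · rintro ⟨t, b⟩ - ⟨t', b'⟩ - h
          simp only at h
          have hB : 0 < B := b.pos
          have h1 : t = t' := by
            have h2 := congrArg (· / B) h
            simpa [Nat.add_div_of_dvd_right, Nat.mul_div_cancel _ hB, add_comm, Nat.add_mul_div_right,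
              hB, Nat.div_eq_of_lt] using h2
          subst h1
          have h3 : b = b' := Fin.ext (by omega)
          subst h3
          rfl
    _ = N := by simp

theorem known_initial (u : Fin N → Fin V) (k : Fin (E - N) → Fin V × Fin V)
    (X : Finset (Fin N → Fin V)) (hB : 1 ≤ B) :
    Known (fun x => inputRecord (edgeListing u x k)) (unknownInBlock V N B) (initialSym V E M B)
      (Finset.range (V + N)) X where
  mem x _ y _ := fun a b => by
    simp [SymState.memKeys, initialSym, inputKey, inputRecord, optRank]
  disk t ht x _ y _ := fun a b => by
    have h1 : ∀ b : Fin B, V + N ≤ t * B + b := fun b => by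
      have := Nat.le_mul_of_pos_right t hB
      simp only [Finset.mem_range] at ht
      omega
    simp only [SymState.blockKeys, initialSym]
    rw [inputKey_edgeListing_known u x y k _ a.2 (by have := h1 a.1; omega),
      inputKey_edgeListing_known u x y k _ b.2 (by have := h1 b.1; omega)]
  fresh t _ := by
    refine ⟨(Finset.univ.filter fun b : Fin B => V ≤ t * B + b ∧ t * B + b < V + N) ×ˢ {1}, ?_,
      fun a ha x _ y _ => ?_⟩
    · simp [unknownInBlock]
    · refine inputKey_edgeListing_known u x y k _ a.2 fun h => ha ?_
      simp only [Finset.mem_product, Finset.mem_filter, Finset.mem_univ, true_and,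
        Finset.mem_singleton]
      exact ⟨⟨h.1, h.2.1⟩, h.2.2⟩

/-- The counting bound for a family of edge lists with unknown endpoints that are even labels. In the
first inequality the order types of the input blocks are paid for once and for all; in the second,
only those blocks count that are read. -/
theorem card_le_of_good {α : Type} (hB : 1 ≤ B) (hN : N ≤ E) (u : Fin N → Fin V)
    (k : Fin (E - N) → Fin V × Fin V) (T : IOTree V M B α) (X : Finset (Fin N → Fin V))
    (heven : ∀ x ∈ X, ∀ p, (x p : ℕ) % 2 = 0) (q : ℕ)
    (H : ∀ A ⊆ X, (∀ x ∈ A, ∀ y ∈ A, ∀ z, Interpolates x y z →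
      T.run (initialState M B (edgeListing u z k)) =
        T.run (initialState M B (edgeListing u x k))) → A.card ≤ q) :
    X.card ≤ q * ((V + 1) * (4 * M + 2 * B).choose (2 * B)) ^ T.depth * (5 * B) ^ N ∧
      X.card ≤ q * ((V + 1) * ((4 * M + 2 * B).choose (2 * B) * (5 * B) ^ B)) ^ T.depth := by
  have hknown := known_initial (M := M) u k X hB
  have hgood : ∀ A ⊆ X, (∀ x ∈ A, ∀ y ∈ A, ∀ v,
      IsMix (inputKey (inputRecord (edgeListing u x k)))
        (inputKey (inputRecord (edgeListing u y k))) (inputKey v) →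
      T.run ((initialSym V E M B).concrete v) =
        T.run ((initialSym V E M B).concrete (inputRecord (edgeListing u x k)))) →
      A.card ≤ q := by
    intro A hA hA'
    refine H A hA fun x hx y hy z hz => ?_
    rw [initialState_eq, initialState_eq]
    exact hA' x hx y hy _ (hz.isMix (heven x (hA hx)) (heven y (hA hy)) hN u k)
  constructor
  · have h1 := card_le_of_tree (R := 1) (pot := fun t => (5 * B) ^ unknownInBlock V N B t) hB le_rfl
      (fun t => Nat.pos_of_ne_zero (by positivity)) (fun t => by simp) q T _ _ X hknown hgood
    rw [mul_one, Finset.prod_pow_eq_pow_sum] at h1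
    exact h1.trans (Nat.mul_le_mul_left _
      (Nat.pow_le_pow_right (by omega) (sum_unknownInBlock_le V N B _)))
  · have h1 := card_le_of_tree (R := (5 * B) ^ B) (pot := fun _ => 1) hB
      (Nat.pos_of_ne_zero (by positivity)) (fun t => le_rfl) (fun t => by
        rw [mul_one]
        exact Nat.pow_le_pow_right (by omega) (unknownInBlock_le V N B t)) q T _ _ X hknown hgood
    simpa using h1

end Family

/-! ### Cuts of graphs given by edge lists -/

section Cuts

variable {V N E : ℕ}

/-- The edge `e` has one endpoint in `S` and one outside. -/
def Crosses (S : Finset (Fin V)) (e : Sym2 (Fin V)) : Prop :=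
  ∃ u ∈ S, ∃ v ∈ Sᶜ, e = s(u, v)

theorem crosses_mk {S : Finset (Fin V)} {a b : Fin V} :
    Crosses S s(a, b) ↔ ¬ (a ∈ S ↔ b ∈ S) := by
  constructor
  · rintro ⟨u, hu, v, hv, h⟩
    rw [Finset.mem_compl] at hv
    rcases Sym2.eq_iff.1 h with ⟨rfl, rfl⟩ | ⟨rfl, rfl⟩ <;> tauto
  · intro h
    by_cases ha : a ∈ S
    · exact ⟨a, ha, b, Finset.mem_compl.2 (by tauto), rfl⟩
    · exact ⟨b, by tauto, a, Finset.mem_compl.2 ha, Sym2.eq_swap⟩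

theorem le_cutValue {G : SimpleGraph (Fin V)} {S : Finset (Fin V)} (F : Finset (Sym2 (Fin V)))
    (hF : ∀ e ∈ F, e ∈ G.edgeSet ∧ Crosses S e) : F.card ≤ cutValue G S := by
  rw [← Set.ncard_coe_finset]
  exact Set.ncard_le_ncard (fun e he => hF e he) (Set.toFinite _)

theorem cutValue_le {G : SimpleGraph (Fin V)} {S : Finset (Fin V)} (F : Finset (Sym2 (Fin V)))
    (hF : ∀ e ∈ G.edgeSet, Crosses S e → e ∈ F) : cutValue G S ≤ F.card := by
  rw [← Set.ncard_coe_finset]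
  exact Set.ncard_le_ncard (fun e he => hF e he.1 he.2) (Set.toFinite _)

/-- If `c` assigns to each vertex a neighbour, and no edge is used in both directions, then a cut
that is left by `c` in both directions has at least two crossing edges. -/
theorem two_le_cutValue {G : SimpleGraph (Fin V)} (c : Fin V → Fin V) (hc : ∀ v, c (c v) ≠ v)
    (hG : ∀ v, s(v, c v) ∈ G.edgeSet) {S : Finset (Fin V)} (h1 : ∃ v ∈ S, c v ∉ S)
    (h2 : ∃ v, v ∉ S ∧ c v ∈ S) : 2 ≤ cutValue G S := by
  obtain ⟨a, ha, hca⟩ := h1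
  obtain ⟨b, hb, hcb⟩ := h2
  have hne : s(a, c a) ≠ s(b, c b) := by
    intro h
    rcases Sym2.eq_iff.1 h with ⟨h1, -⟩ | ⟨h1, h2⟩
    · exact hb (h1 ▸ ha)
    · exact hc b (by rw [← h1, h2])
  rw [← Finset.card_pair hne]
  refine le_cutValue _ fun e he => ?_
  rcases Finset.mem_insert.1 he with rfl | he
  · exact ⟨hG a, crosses_mk.2 (by tauto)⟩
  · rw [Finset.mem_singleton.1 he]
    exact ⟨hG b, crosses_mk.2 (by tauto)⟩

theorem connected_of_cutValue_pos {G : SimpleGraph (Fin V)} (hV : 0 < V)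
    (h : ∀ S, IsCut S → 1 ≤ cutValue G S) : G.Connected := by
  classical
  rw [SimpleGraph.connected_iff_exists_forall_reachable]
  refine ⟨⟨0, hV⟩, ?_⟩
  by_contra hcon
  push Not at hcon
  obtain ⟨b, hb⟩ := hcon
  let S : Finset (Fin V) := Finset.univ.filter fun v => G.Reachable ⟨0, hV⟩ v
  have hS : IsCut S := ⟨⟨⟨0, hV⟩, by simp [S]⟩, ⟨b, by simpa [S] using hb⟩⟩
  have h1 := cutValue_le (G := G) (S := S) ∅ fun e he hce => by
    exfalso
    obtain ⟨u, hu, v, hv, rfl⟩ := hce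
    simp only [S, Finset.mem_compl, Finset.mem_filter, Finset.mem_univ, true_and] at hu hv
    exact hv (hu.trans (SimpleGraph.Adj.reachable he))
  have h2 := h S hS
  simp at h1
  omega

/-- The graph with the edges in `K` and the edges between `u p` and `x p`. -/
def listedGraph (K : Finset (Sym2 (Fin V))) (u x : Fin N → Fin V) : SimpleGraph (Fin V) :=
  SimpleGraph.fromEdgeSet (K ∪ Set.range fun p => s(u p, x p))

/-- The pairs `(u p, x p)` are distinct edges outside `K`. -/
structure IsSimpleListing (K : Finset (Sym2 (Fin V))) (u x : Fin N → Fin V) : Prop where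
  inj : Function.Injective fun p => s(u p, x p)
  notMem : ∀ p, s(u p, x p) ∉ K
  ne : ∀ p, u p ≠ x p

theorem mem_edgeSet_listedGraph {K : Finset (Sym2 (Fin V))} {u x : Fin N → Fin V}
    (hK : ∀ e ∈ K, ¬ e.IsDiag) (hx : ∀ p, u p ≠ x p) {e : Sym2 (Fin V)} :
    e ∈ (listedGraph K u x).edgeSet ↔ e ∈ K ∨ ∃ p, s(u p, x p) = e := by
  rw [listedGraph, SimpleGraph.edgeSet_fromEdgeSet]
  constructor
  · rintro ⟨h1 | h1, -⟩
    · exact Or.inl h1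
    · exact Or.inr h1
  · rintro (h1 | ⟨p, rfl⟩)
    · exact ⟨Or.inl h1, fun h => hK e h1 h⟩
    · exact ⟨Or.inr ⟨p, rfl⟩, fun h => hx p h⟩

/-- The edges in `K` can be listed. -/
theorem exists_listing (K : Finset (Sym2 (Fin V))) {m : ℕ} (hm : K.card = m) :
    ∃ k : Fin m → Fin V × Fin V, Function.Injective (fun i => s((k i).1, (k i).2)) ∧
      Set.range (fun i => s((k i).1, (k i).2)) = K := by
  let f := (K.equivFinOfCardEq hm).symm
  have hk : ∀ i, s(((f i : Sym2 (Fin V)).out).1, ((f i : Sym2 (Fin V)).out).2) = f i := fun i =>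
    Quot.out_eq _
  refine ⟨fun i => (f i : Sym2 (Fin V)).out, ?_, ?_⟩
  · intro i i' h
    simp only [hk] at h
    exact f.injective (Subtype.ext h)
  · simp only [hk]
    ext e
    constructor
    · rintro ⟨i, rfl⟩
      exact (f i).2
    · intro he
      exact ⟨f.symm ⟨e, he⟩, by simp⟩

theorem isEdgeList_edgeListing {K : Finset (Sym2 (Fin V))} {u x : Fin N → Fin V} (hN : N ≤ E)
    (hK : ∀ e ∈ K, ¬ e.IsDiag) (hx : IsSimpleListing K u x) (k : Fin (E - N) → Fin V × Fin V)
    (hk : Function.Injective (fun i => s((k i).1, (k i).2)))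
    (hkK : Set.range (fun i => s((k i).1, (k i).2)) = K) :
    IsEdgeList (listedGraph K u x) (edgeListing u x k) := by
  have hmem : ∀ i, s((k i).1, (k i).2) ∈ K := fun i => by
    rw [← Finset.mem_coe, ← hkK]
    exact ⟨i, rfl⟩
  constructor
  · intro i i' h
    simp only [edgeListing] at h
    split_ifs at h with h1 h2 h2
    · have := hx.inj h
      simp only [Fin.mk.injEq] at this
      exact Fin.ext this
    · exact absurd (h ▸ hmem _) (hx.notMem ⟨i, h1⟩)
    · exact absurd (h ▸ hmem _) (hx.notMem ⟨i', h2⟩)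
    · have := hk h
      simp only [Fin.mk.injEq] at this
      exact Fin.ext (by omega)
  · ext e
    rw [mem_edgeSet_listedGraph hK hx.ne]
    constructor
    · rintro ⟨i, rfl⟩
      simp only [edgeListing]
      split_ifs with h1
      · exact Or.inr ⟨_, rfl⟩
      · exact Or.inl (hmem _)
    · rintro (he | ⟨p, rfl⟩)
      · rw [← Finset.mem_coe, ← hkK] at he
        obtain ⟨i, rfl⟩ := he
        refine ⟨⟨N + i, by omega⟩, ?_⟩
        simp [edgeListing]
      · exact ⟨⟨p, by omega⟩, by simp [edgeListing]⟩

end Cuts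

/-! ### What an answer can be -/

section Answers

variable {V : ℕ} {α : Type}

/-- If the graphs in a set have neither a common minimum cut value nor a common minimum cut, then
they have no common correct answer in the sense of `Ans`. This holds for both kinds of answers. -/
def IsMinCutAnswer (Ans : SimpleGraph (Fin V) → α → Prop) : Prop :=
  ∀ 𝒢 : Set (SimpleGraph (Fin V)), (¬ ∃ c, ∀ G ∈ 𝒢, IsMinCutValue G c) →
    (¬ ∃ S, ∀ G ∈ 𝒢, IsMinCut G S) → ¬ ∃ a, ∀ G ∈ 𝒢, Ans G a

theorem isMinCutAnswer_value : IsMinCutAnswer (V := V) IsMinCutValue := fun _ h _ => h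

theorem isMinCutAnswer_cut : IsMinCutAnswer (V := V) IsMinCut := fun _ _ h => h

theorem crosses_compl {S : Finset (Fin V)} {e : Sym2 (Fin V)} : Crosses Sᶜ e ↔ Crosses S e := by
  induction e with
  | _ a b => simp only [crosses_mk, Finset.mem_compl]; tauto

theorem cutValue_compl (G : SimpleGraph (Fin V)) (S : Finset (Fin V)) :
    cutValue G Sᶜ = cutValue G S := by
  unfold cutValue
  congr 1
  ext e
  exact and_congr_right fun _ => crosses_compl

end Answers

/-! ### Many edges: two components joined by a bridge -/

section Bridge

variable {V n ℓ d N E M B : ℕ}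

/-- The successor of a label in one of two cycles: the odd labels below `2 * n` in increasing order,
and the even labels below `2 * n` followed by all labels from `2 * n` on. -/
def twoCycleNext (V n a : ℕ) : ℕ :=
  if a + 2 ≤ 2 * n then a + 2 else if a + 1 = 2 * n then 1 else if a + 1 = V then 0 else a + 1

theorem twoCycleNext_lt (hV : V = 2 * n + ℓ + 2) {a : ℕ} (ha : a < V) :
    twoCycleNext V n a < V := by
  unfold twoCycleNext
  split_ifs <;> omega

/-- The map `twoCycleNext` on vertices. -/
def twoCycle (hV : V = 2 * n + ℓ + 2) (v : Fin V) : Fin V :=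
  ⟨twoCycleNext V n v, twoCycleNext_lt hV v.2⟩

/-- The side of the bridge that contains the even labels below `2 * n` and all labels from `2 * n`
on. -/
def evenSide (V n : ℕ) : Finset (Fin V) :=
  Finset.univ.filter fun v => (v : ℕ) % 2 = 0 ∨ 2 * n ≤ v

theorem mem_evenSide {v : Fin V} : v ∈ evenSide V n ↔ (v : ℕ) % 2 = 0 ∨ 2 * n ≤ (v : ℕ) := by
  simp [evenSide]

/-- The vertices that carry the additional edges: the labels from `2 * n + 1` to `V - 2`. -/
def denseSide (V n : ℕ) : Finset (Fin V) :=
  Finset.univ.filter fun v => 2 * n + 1 ≤ (v : ℕ) ∧ (v : ℕ) + 2 ≤ V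

/-- The edges of the two cycles and the bridge between the labels `0` and `1`. -/
def bridgeCore (hV : V = 2 * n + ℓ + 2) (hn : 3 ≤ n) : Finset (Sym2 (Fin V)) :=
  insert s(⟨0, by omega⟩, ⟨1, by omega⟩) (Finset.univ.image fun v => s(v, twoCycle hV v))

/-- The edges in `K` are those of `bridgeCore` and some edges inside `denseSide`. -/
structure IsBridgeFrame (hV : V = 2 * n + ℓ + 2) (hn : 3 ≤ n) (K : Finset (Sym2 (Fin V))) :
    Prop where
  core : bridgeCore hV hn ⊆ K
  le : K ⊆ bridgeCore hV hn ∪ (denseSide V n).offDiag.image (Function.uncurry Sym2.mk)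

theorem card_denseSide (hV : V = 2 * n + ℓ + 2) : (denseSide V n).card = ℓ := by
  have h1 : (denseSide V n).map Fin.valEmbedding = Finset.Ico (2 * n + 1) (2 * n + 1 + ℓ) := by
    ext a
    simp only [denseSide, Finset.mem_map, Finset.mem_filter, Finset.mem_univ, true_and,
      Fin.valEmbedding_apply, Finset.mem_Ico]
    constructor
    · rintro ⟨v, hv, rfl⟩
      omega
    · intro ha
      exact ⟨⟨a, by omega⟩, ⟨by simp only; omega, by simp only; omega⟩, rfl⟩
  rw [← Finset.card_map Fin.valEmbedding, h1, Nat.card_Ico]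
  omega

theorem exists_isBridgeFrame (hV : V = 2 * n + ℓ + 2) (hn : 3 ≤ n) {m : ℕ} (h1 : V + 1 ≤ m)
    (h2 : m ≤ ℓ.choose 2) : ∃ K, IsBridgeFrame hV hn K ∧ K.card = m := by
  have h3 : (bridgeCore hV hn).card ≤ m := by
    refine (Finset.card_insert_le _ _).trans ((Nat.succ_le_succ Finset.card_image_le).trans ?_)
    simpa using h1
  have h4 : m ≤ (bridgeCore hV hn ∪
      (denseSide V n).offDiag.image (Function.uncurry Sym2.mk)).card := by
    have h5 := Sym2.card_image_offDiag (denseSide V n)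
    rw [card_denseSide hV] at h5
    exact h2.trans (h5.symm.le.trans (Finset.card_le_card Finset.subset_union_right))
  obtain ⟨K, hK1, hK2, hK3⟩ :=
    Finset.exists_subsuperset_card_eq Finset.subset_union_left h3 h4
  exact ⟨K, ⟨hK1, hK2⟩, hK3⟩

theorem IsBridgeFrame.cases {hV : V = 2 * n + ℓ + 2} {hn : 3 ≤ n} {K : Finset (Sym2 (Fin V))}
    (hK : IsBridgeFrame hV hn K) {e : Sym2 (Fin V)} (he : e ∈ K) :
    ∃ a b : Fin V, e = s(a, b) ∧ (((a : ℕ) = 0 ∧ (b : ℕ) = 1) ∨ (b : ℕ) = twoCycleNext V n a ∨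
      (a ≠ b ∧ 2 * n + 1 ≤ (a : ℕ) ∧ (a : ℕ) + 2 ≤ V ∧ 2 * n + 1 ≤ (b : ℕ) ∧ (b : ℕ) + 2 ≤ V)) := by
  rcases Finset.mem_union.1 (hK.le he) with h | h
  · rcases Finset.mem_insert.1 h with rfl | h
    · exact ⟨_, _, rfl, Or.inl ⟨rfl, rfl⟩⟩
    · obtain ⟨v, -, rfl⟩ := Finset.mem_image.1 h
      exact ⟨_, _, rfl, Or.inr (Or.inl rfl)⟩
  · obtain ⟨⟨a, b⟩, hab, rfl⟩ := Finset.mem_image.1 h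
    rw [Finset.mem_offDiag] at hab
    simp only [denseSide, Finset.mem_filter, Finset.mem_univ, true_and] at hab
    exact ⟨a, b, rfl, Or.inr (Or.inr ⟨hab.2.2, hab.1.1, hab.1.2, hab.2.1.1, hab.2.1.2⟩)⟩

theorem IsBridgeFrame.not_isDiag {hV : V = 2 * n + ℓ + 2} {hn : 3 ≤ n}
    {K : Finset (Sym2 (Fin V))} (hK : IsBridgeFrame hV hn K) : ∀ e ∈ K, ¬ e.IsDiag := by
  intro e he
  obtain ⟨a, b, rfl, h⟩ := hK.cases he
  intro hab
  rw [Sym2.mk_isDiag_iff] at hab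
  subst hab
  unfold twoCycleNext at h
  split_ifs at h <;> omega

/-- The unknown edges lead from `denseSide` to labels below `2 * n`; even when each label is known
only up to its last bit, the edges are distinct. -/
structure IsDenseListing (V n : ℕ) (u x : Fin N → Fin V) : Prop where
  left : ∀ p, 2 * n + 1 ≤ (u p : ℕ) ∧ (u p : ℕ) + 2 ≤ V
  right : ∀ p, (x p : ℕ) < 2 * n
  inj : ∀ p p', u p = u p' → (x p : ℕ) / 2 = (x p' : ℕ) / 2 → p = p'

theorem IsDenseListing.isSimpleListing {hV : V = 2 * n + ℓ + 2} {hn : 3 ≤ n}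
    {K : Finset (Sym2 (Fin V))} (hK : IsBridgeFrame hV hn K) {u x : Fin N → Fin V}
    (hx : IsDenseListing V n u x) : IsSimpleListing K u x where
  inj p p' h := by
    have h1 := hx.left p
    have h2 := hx.right p
    have h3 := hx.left p'
    have h4 := hx.right p'
    rcases Sym2.eq_iff.1 h with ⟨h5, h6⟩ | ⟨h5, h6⟩
    · exact hx.inj p p' h5 (by rw [h6])
    · have := congrArg Fin.val h5
      omega
  notMem p h := by
    have h1 := hx.left p
    have h2 := hx.right p
    obtain ⟨a, b, hab, h⟩ := hK.cases h
    unfold twoCycleNext at h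
    rcases Sym2.eq_iff.1 hab with ⟨h5, h6⟩ | ⟨h5, h6⟩ <;> rw [h5] at h1 <;> rw [h6] at h2 <;>
      split_ifs at h <;> omega
  ne p h := by
    have h1 := hx.left p
    have h2 := hx.right p
    have := congrArg Fin.val h
    omega

/-- A set of vertices that is closed under `twoCycle` and contains a vertex of a cycle contains the
whole cycle. -/
theorem subset_of_twoCycle_closed (hV : V = 2 * n + ℓ + 2) (hn : 3 ≤ n) {S : Finset (Fin V)}
    (hS : ∀ v ∈ S, twoCycle hV v ∈ S) :
    ((∃ v ∈ S, v ∈ evenSide V n) → ∀ v ∈ evenSide V n, v ∈ S) ∧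
      ((∃ v ∈ S, v ∉ evenSide V n) → ∀ v, v ∉ evenSide V n → v ∈ S) := by
  let Q : ℕ → Prop := fun a => ∃ h : a < V, (⟨a, h⟩ : Fin V) ∈ S
  have step : ∀ a, Q a → Q (twoCycleNext V n a) := fun a ⟨h, ha⟩ => ⟨_, hS _ ha⟩
  have step' : ∀ a b, Q a → twoCycleNext V n a = b → Q b := fun a b ha hb => hb ▸ step a ha
  have start : ∀ k a, a + k = V → (a % 2 = 0 ∨ 2 * n ≤ a) → Q a → Q 0 := by
    intro k
    induction k using Nat.strong_induction_on with
    | _ k ih =>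
      intro a hak ha hQ
      by_cases h1 : a + 2 ≤ 2 * n
      · exact ih (k - 2) (by omega) (a + 2) (by omega) (by omega)
          (step' a _ hQ (by simp [twoCycleNext, h1]))
      · by_cases h2 : a + 1 = V
        · exact step' a _ hQ (by unfold twoCycleNext; split_ifs <;> omega)
        · have h3 := hQ.1
          exact ih (k - 1) (by omega) (a + 1) (by omega) (by omega)
            (step' a _ hQ (by unfold twoCycleNext; split_ifs <;> omega))
  have reach : Q 0 → ∀ a, a < V → (a % 2 = 0 ∨ 2 * n ≤ a) → Q a := by
    intro h0 a
    induction a using Nat.strong_induction_on with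
    | _ a ih =>
      intro haV ha
      by_cases h1 : a = 0
      · exact h1 ▸ h0
      · by_cases h2 : a ≤ 2 * n
        · exact step' (a - 2) a (ih (a - 2) (by omega) (by omega) (by omega))
            (by unfold twoCycleNext; split_ifs <;> omega)
        · exact step' (a - 1) a (ih (a - 1) (by omega) (by omega) (by omega))
            (by unfold twoCycleNext; split_ifs <;> omega)
  have startB : ∀ k a, a + k = 2 * n → a % 2 = 1 → Q a → Q 1 := by
    intro k
    induction k using Nat.strong_induction_on with
    | _ k ih =>
      intro a hak ha hQ
      by_cases h1 : a + 2 ≤ 2 * n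
      · exact ih (k - 2) (by omega) (a + 2) (by omega) (by omega)
          (step' a _ hQ (by simp [twoCycleNext, h1]))
      · by_cases h2 : a + 1 = 2 * n
        · exact step' a _ hQ (by unfold twoCycleNext; split_ifs; omega)
        · have : a = 2 * n := by omega
          omega
  have reachB : Q 1 → ∀ a, a < 2 * n → a % 2 = 1 → Q a := by
    intro h0 a
    induction a using Nat.strong_induction_on with
    | _ a ih =>
      intro haV ha
      by_cases h1 : a = 1
      · exact h1 ▸ h0
      · exact step' (a - 2) a (ih (a - 2) (by omega) (by omega) (by omega))
          (by unfold twoCycleNext; split_ifs <;> omega)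
  constructor
  · rintro ⟨v, hv, hvA⟩ w hw
    rw [mem_evenSide] at hvA hw
    exact (reach (start (V - v) v (by omega) hvA ⟨v.2, hv⟩) w w.2 hw).2
  · rintro ⟨v, hv, hvA⟩ w hw
    rw [mem_evenSide] at hvA hw
    exact (reachB (startB (2 * n - v) v (by omega) (by omega) ⟨v.2, hv⟩) w (by omega)
      (by omega)).2

theorem exists_twoCycle_notMem (hV : V = 2 * n + ℓ + 2) (hn : 3 ≤ n) {S : Finset (Fin V)}
    (hS : IsCut S) (h1 : S ≠ evenSide V n) (h2 : S ≠ (evenSide V n)ᶜ) :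
    ∃ v ∈ S, twoCycle hV v ∉ S := by
  by_contra hcon
  push Not at hcon
  obtain ⟨hA, hB⟩ := subset_of_twoCycle_closed hV hn hcon
  obtain ⟨⟨a, ha⟩, b, hb⟩ := hS
  rw [Finset.mem_compl] at hb
  by_cases hex : ∃ v ∈ S, v ∈ evenSide V n
  · by_cases hex' : ∃ v ∈ S, v ∉ evenSide V n
    · by_cases hbA : b ∈ evenSide V n
      · exact hb (hA hex b hbA)
      · exact hb (hB hex' b hbA)
    · push Not at hex'
      exact h1 (Finset.Subset.antisymm hex' fun v hv => hA hex v hv)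
  · push Not at hex
    refine h2 (Finset.Subset.antisymm (fun v hv => Finset.mem_compl.2 (hex v hv)) fun v hv => ?_)
    exact hB ⟨a, ha, hex a ha⟩ v (Finset.mem_compl.1 hv)

section

variable {hV : V = 2 * n + ℓ + 2} {hn : 3 ≤ n} {K : Finset (Sym2 (Fin V))}
  {u x : Fin N → Fin V}

theorem two_le_cutValue_of_ne_evenSide (hK : IsBridgeFrame hV hn K) (hx : IsDenseListing V n u x)
    {S : Finset (Fin V)} (hS : IsCut S) (h1 : S ≠ evenSide V n) (h2 : S ≠ (evenSide V n)ᶜ) :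
    2 ≤ cutValue (listedGraph K u x) S := by
  refine two_le_cutValue (twoCycle hV) (fun v h => ?_) (fun v => ?_)
    (exists_twoCycle_notMem hV hn hS h1 h2) ?_
  · have h3 := congrArg Fin.val h
    simp only [twoCycle, twoCycleNext] at h3
    have := v.2
    split_ifs at h3 <;> omega
  · rw [mem_edgeSet_listedGraph hK.not_isDiag (hx.isSimpleListing hK).ne]
    exact Or.inl (hK.core (Finset.mem_insert_of_mem (Finset.mem_image_of_mem _ (Finset.mem_univ v))))
  · obtain ⟨v, hv, hcv⟩ := exists_twoCycle_notMem hV hn (S := Sᶜ)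
      ⟨hS.2, by rw [compl_compl]; exact hS.1⟩ (fun h => h2 (by rw [← h, compl_compl]))
      (fun h => h1 (compl_injective h))
    exact ⟨v, Finset.mem_compl.1 hv, by simpa using hcv⟩

theorem isCut_evenSide (hV : V = 2 * n + ℓ + 2) (hn : 3 ≤ n) : IsCut (evenSide V n) :=
  ⟨⟨⟨0, by omega⟩, mem_evenSide.2 (Or.inl rfl)⟩,
    ⟨⟨1, by omega⟩, by rw [Finset.mem_compl, mem_evenSide]; simp only; omega⟩⟩

/-- The bridge and the unknown edges that end in an odd label cross the cut `evenSide`. -/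
theorem le_cutValue_evenSide (hK : IsBridgeFrame hV hn K) (hx : IsDenseListing V n u x)
    (P : Finset (Fin N)) (hP : ∀ p ∈ P, (x p : ℕ) % 2 = 1) :
    P.card + 1 ≤ cutValue (listedGraph K u x) (evenSide V n) := by
  have hs := hx.isSimpleListing hK
  have hbr : s((⟨0, by omega⟩ : Fin V), ⟨1, by omega⟩) ∈ K := hK.core (Finset.mem_insert_self _ _)
  rw [← Finset.card_image_of_injective P hs.inj, ← Finset.card_insert_of_notMem
    (a := s((⟨0, by omega⟩ : Fin V), ⟨1, by omega⟩))]
  · refine le_cutValue _ fun e he => ?_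
    rw [mem_edgeSet_listedGraph hK.not_isDiag hs.ne]
    rcases Finset.mem_insert.1 he with rfl | he
    · refine ⟨Or.inl hbr, ?_⟩
      rw [crosses_mk, mem_evenSide, mem_evenSide]
      have h0 : ¬ 2 * n ≤ 1 := by omega
      simp [h0]
    · obtain ⟨p, hp, rfl⟩ := Finset.mem_image.1 he
      refine ⟨Or.inr ⟨p, rfl⟩, ?_⟩
      have h1 := hx.left p
      have h2 := hx.right p
      have h3 := hP p hp
      rw [crosses_mk, mem_evenSide, mem_evenSide]
      omega
  · intro h
    obtain ⟨p, -, h⟩ := Finset.mem_image.1 h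
    exact hs.notMem p (h ▸ hbr)

theorem cutValue_evenSide_le (hK : IsBridgeFrame hV hn K) (hx : IsDenseListing V n u x)
    (heven : ∀ p, (x p : ℕ) % 2 = 0) : cutValue (listedGraph K u x) (evenSide V n) ≤ 1 := by
  have hs := hx.isSimpleListing hK
  refine cutValue_le {s((⟨0, by omega⟩ : Fin V), ⟨1, by omega⟩)} fun e he hce => ?_
  rw [mem_edgeSet_listedGraph hK.not_isDiag hs.ne] at he
  rcases he with he | ⟨p, rfl⟩
  · obtain ⟨a, b, rfl, h⟩ := hK.cases he
    rw [crosses_mk, mem_evenSide, mem_evenSide] at hce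
    have h1 := a.2
    have h2 : (a : ℕ) = 0 ∧ (b : ℕ) = 1 := by
      unfold twoCycleNext at h
      split_ifs at h <;> omega
    rw [Finset.mem_singleton, Sym2.eq_iff]
    exact Or.inl ⟨Fin.ext h2.1, Fin.ext h2.2⟩
  · have h1 := hx.left p
    have h3 := heven p
    rw [crosses_mk, mem_evenSide, mem_evenSide] at hce
    omega

/-- The last vertex has degree two. -/
theorem cutValue_last_le (hK : IsBridgeFrame hV hn K) (hx : IsDenseListing V n u x) :
    cutValue (listedGraph K u x) {⟨V - 1, by omega⟩} ≤ 2 := by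
  have hs := hx.isSimpleListing hK
  refine (cutValue_le {s((⟨V - 2, by omega⟩ : Fin V), ⟨V - 1, by omega⟩),
    s((⟨V - 1, by omega⟩ : Fin V), ⟨0, by omega⟩)} fun e he hce => ?_).trans Finset.card_le_two
  rw [mem_edgeSet_listedGraph hK.not_isDiag hs.ne] at he
  rcases he with he | ⟨p, rfl⟩
  · obtain ⟨a, b, rfl, h⟩ := hK.cases he
    rw [crosses_mk, Finset.mem_singleton, Finset.mem_singleton, Fin.ext_iff, Fin.ext_iff] at hce
    simp only [Finset.mem_insert, Finset.mem_singleton, Sym2.eq_iff, Fin.ext_iff]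
    have h1 := a.2
    unfold twoCycleNext at h
    simp only at hce
    split_ifs at h <;> omega
  · have h1 := hx.left p
    have h2 := hx.right p
    rw [crosses_mk, Finset.mem_singleton, Finset.mem_singleton, Fin.ext_iff, Fin.ext_iff] at hce
    simp only at hce
    omega

theorem connected_of_isBridgeFrame (hK : IsBridgeFrame hV hn K) (hx : IsDenseListing V n u x) :
    (listedGraph K u x).Connected := by
  refine connected_of_cutValue_pos (by omega) fun S hS => ?_
  have h0 := le_cutValue_evenSide hK hx ∅ (by simp)
  by_cases h1 : S = evenSide V n
  · rw [h1]
    omega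
  · by_cases h2 : S = (evenSide V n)ᶜ
    · rw [h2, cutValue_compl]
      omega
    · have := two_le_cutValue_of_ne_evenSide hK hx hS h1 h2
      omega

/-- Moving two unknown edges to the other side of the bridge leaves no common answer: before, the
bridge is the only minimum cut; afterwards, the cut at the last vertex is smaller. -/
theorem no_common_answer_of_bridge {α : Type} {Ans : SimpleGraph (Fin V) → α → Prop}
    (hAns : IsMinCutAnswer Ans) (hK : IsBridgeFrame hV hn K) {z : Fin N → Fin V}
    (hx : IsDenseListing V n u x) (hz : IsDenseListing V n u z)
    (heven : ∀ p, (x p : ℕ) % 2 = 0) {p p' : Fin N} (hp : p ≠ p')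
    (h1 : (z p : ℕ) % 2 = 1) (h2 : (z p' : ℕ) % 2 = 1) (a : α) (hxa : Ans (listedGraph K u x) a)
    (hza : Ans (listedGraph K u z) a) : False := by
  have hz3 : 3 ≤ cutValue (listedGraph K u z) (evenSide V n) := by
    have := le_cutValue_evenSide hK hz {p, p'} (by
      intro r hr
      rcases Finset.mem_insert.1 hr with rfl | hr
      · exact h1
      · rw [Finset.mem_singleton.1 hr]
        exact h2)
    rwa [Finset.card_pair hp] at this
  have hx1 := cutValue_evenSide_le hK hx heven
  have hz2 : ∀ S, IsCut S → 2 ≤ cutValue (listedGraph K u z) S := by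
    intro S hS
    by_cases h1 : S = evenSide V n
    · rw [h1]
      omega
    · by_cases h2 : S = (evenSide V n)ᶜ
      · rw [h2, cutValue_compl]
        omega
      · exact two_le_cutValue_of_ne_evenSide hK hz hS h1 h2
  have hcut := isCut_evenSide hV hn
  refine hAns {listedGraph K u x, listedGraph K u z} ?_ ?_ ⟨a, ?_⟩
  · rintro ⟨c, hc⟩
    obtain ⟨S, hS, hSc⟩ := hc _ (Set.mem_insert _ _)
    obtain ⟨S', hS', hSc'⟩ := hc _ (Set.mem_insert_of_mem _ (Set.mem_singleton _))
    have h3 := hS.2 _ hcut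
    have h4 := hz2 S' hS'.1
    omega
  · rintro ⟨S, hS⟩
    have hSx := hS _ (Set.mem_insert _ _)
    have hSz := hS _ (Set.mem_insert_of_mem _ (Set.mem_singleton _))
    have h3 := hSx.2 _ hcut
    have h4 : cutValue (listedGraph K u z) S = cutValue (listedGraph K u z) (evenSide V n) := by
      by_cases h1 : S = evenSide V n
      · rw [h1]
      · by_cases h2 : S = (evenSide V n)ᶜ
        · rw [h2, cutValue_compl]
        · have := two_le_cutValue_of_ne_evenSide hK hx hSx.1 h1 h2
          omega
    have h5 := hSz.2 {⟨V - 1, by omega⟩} ⟨Finset.singleton_nonempty _, ⟨⟨0, by omega⟩, by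
      rw [Finset.mem_compl, Finset.mem_singleton, Fin.ext_iff]; simp only; omega⟩⟩
    have h6 := cutValue_last_le hK hz
    omega
  · rintro G (rfl | rfl)
    · exact hxa
    · exact hza

end

/-- A set of sequences any two of which differ in at most two places is small. -/
theorem card_le_of_differ_le_two (A : Finset (Fin N → Fin V))
    (hA : ∀ x ∈ A, ∀ y ∈ A, ∃ p p', ∀ r, r ≠ p → r ≠ p' → x r = y r) :
    A.card ≤ (N * V) ^ 2 := by
  classical
  rcases A.eq_empty_or_nonempty with rfl | ⟨x, hx⟩
  · simp
  have hsub : A ⊆ (Finset.univ : Finset ((Fin N × Fin V) × (Fin N × Fin V))).image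
      fun a => Function.update (Function.update x a.1.1 a.1.2) a.2.1 a.2.2 := by
    intro y hy
    obtain ⟨p, p', h⟩ := hA x hx y hy
    refine Finset.mem_image.2 ⟨((p, y p), (p', y p')), Finset.mem_univ _, ?_⟩
    funext r
    by_cases h2 : r = p'
    · subst h2
      simp
    · by_cases h1 : r = p
      · subst h1
        simp [Function.update_of_ne h2]
      · simp [Function.update_of_ne h2, Function.update_of_ne h1, h r h1 h2]
  refine (Finset.card_le_card hsub).trans (Finset.card_image_le.trans ?_)
  simp [sq]

/-- The counting bound for graphs with many edges. -/
theorem card_le_of_bridge {α : Type} {Ans : SimpleGraph (Fin V) → α → Prop}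
    (hAns : IsMinCutAnswer Ans) (hV : V = 2 * n + ℓ + 2) (hn : 3 ≤ n) (hN : 1 ≤ ℓ * d)
    (hE1 : V + 1 + ℓ * d ≤ E) (hE2 : E ≤ ℓ * d + ℓ.choose 2) (hB : 1 ≤ B) (T : IOTree V M B α)
    (hT : ∀ (G : SimpleGraph (Fin V)) (e : Fin E → Fin V × Fin V), G.Connected → IsEdgeList G e →
      Ans G (T.run (initialState M B e))) :
    (n.descFactorial d) ^ ℓ ≤ (ℓ * d * V) ^ 2 *
        ((V + 1) * (4 * M + 2 * B).choose (2 * B)) ^ T.depth * (5 * B) ^ (ℓ * d) ∧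
      (n.descFactorial d) ^ ℓ ≤ (ℓ * d * V) ^ 2 *
        ((V + 1) * ((4 * M + 2 * B).choose (2 * B) * (5 * B) ^ B)) ^ T.depth := by
  classical
  obtain ⟨K, hK, hKc⟩ := exists_isBridgeFrame hV hn (m := E - ℓ * d) (by omega) (by omega)
  obtain ⟨k, hk1, hk2⟩ := exists_listing K hKc
  have hNE : ℓ * d ≤ E := by omega
  let u : Fin (ℓ * d) → Fin V := fun p => ⟨2 * n + 1 + p.divNat, by
    have := p.divNat.2
    omega⟩
  let F : (Fin ℓ → Fin d ↪ Fin n) → Fin (ℓ * d) → Fin V := fun h p =>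
    ⟨2 * h p.divNat p.modNat, by
      have := (h p.divNat p.modNat).2
      omega⟩
  have hF : Function.Injective F := by
    intro h h' hhh
    funext i
    ext j
    have h1 := congrArg Fin.val (congrFun hhh (finProdFinEquiv (i, j)))
    have h2 : (finProdFinEquiv (i, j)).divNat = i :=
      congrArg Prod.fst (finProdFinEquiv.symm_apply_apply (i, j))
    have h3 : (finProdFinEquiv (i, j)).modNat = j :=
      congrArg Prod.snd (finProdFinEquiv.symm_apply_apply (i, j))
    simp only [F, h2, h3] at h1
    omega
  have hcard : (Finset.univ.image F).card = (n.descFactorial d) ^ ℓ := by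
    rw [Finset.card_image_of_injective _ hF, Finset.card_univ, Fintype.card_fun,
      Fintype.card_embedding_eq, Fintype.card_fin, Fintype.card_fin, Fintype.card_fin]
  have heven : ∀ x ∈ Finset.univ.image F, ∀ p, (x p : ℕ) % 2 = 0 := by
    intro x hx p
    obtain ⟨h, -, rfl⟩ := Finset.mem_image.1 hx
    simp [F]
  have hleft : ∀ p, 2 * n + 1 ≤ (u p : ℕ) ∧ (u p : ℕ) + 2 ≤ V := fun p => by
    have := p.divNat.2
    simp only [u]
    omega
  have hlisting : ∀ x ∈ Finset.univ.image F, IsDenseListing V n u x := by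
    intro x hx
    obtain ⟨h, -, rfl⟩ := Finset.mem_image.1 hx
    refine ⟨hleft, fun p => ?_, fun p p' h1 h2 => ?_⟩
    · have := (h p.divNat p.modNat).2
      simp only [F]
      omega
    · have h3 : p.divNat = p'.divNat := by
        have := congrArg Fin.val h1
        simp only [u] at this
        exact Fin.ext (by omega)
      have h4 : p.modNat = p'.modNat := by
        simp only [F, h3] at h2
        exact (h p'.divNat).injective (Fin.ext (by omega))
      exact finProdFinEquiv.symm.injective (Prod.ext h3 h4)
  rw [← hcard]
  refine card_le_of_good hB hNE u k T _ heven _ fun A hA hgood => ?_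
  refine card_le_of_differ_le_two A fun x hx y hy => ?_
  -- at most one unknown endpoint lies lower in one input than in another one
  have key : ∀ x ∈ A, ∀ y ∈ A, ∀ p p', (x p : ℕ) < y p → (x p' : ℕ) < y p' → p = p' := by
    intro x hx y hy p p' hp hp'
    by_contra hne
    have hxl := hlisting x (hA hx)
    have hxe := heven x (hA hx)
    let z : Fin (ℓ * d) → Fin V := fun r =>
      if h : (x r : ℕ) < y r then ⟨x r + 1, by omega⟩ else x r
    have hz1 : ∀ r, (x r : ℕ) < y r → (z r : ℕ) = x r + 1 := fun r hr => by simp only [z, dif_pos hr]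
    have hz2 : ∀ r, ¬ (x r : ℕ) < y r → z r = x r := fun r hr => by simp only [z, dif_neg hr]
    have hz3 : ∀ r, (z r : ℕ) / 2 = (x r : ℕ) / 2 := fun r => by
      have := hxe r
      by_cases hr : (x r : ℕ) < y r
      · rw [hz1 r hr]
        omega
      · rw [hz2 r hr]
    have hz : IsDenseListing V n u z := ⟨hleft, fun r => by
      have := hz3 r
      have := hxl.right r
      omega, fun r r' h1 h2 => hxl.inj r r' h1 (by rw [← hz3, ← hz3, h2])⟩
    have hint : Interpolates x y z := by
      refine ⟨fun r => ?_, fun r r' h1 h2 => ?_⟩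
      · by_cases hr : (x r : ℕ) < y r
        · exact Or.inr (Or.inl ⟨hr, hz1 r hr⟩)
        · exact Or.inl (hz2 r hr)
      · simp only [z, h1, h2]
    have hrun := hgood x hx y hy z hint
    have hax := hT _ _ (connected_of_isBridgeFrame hK hxl)
      (isEdgeList_edgeListing hNE hK.not_isDiag (hxl.isSimpleListing hK) k hk1 hk2)
    have haz := hT _ _ (connected_of_isBridgeFrame hK hz)
      (isEdgeList_edgeListing hNE hK.not_isDiag (hz.isSimpleListing hK) k hk1 hk2)
    rw [hrun] at haz
    refine no_common_answer_of_bridge hAns hK hxl hz hxe hne ?_ ?_ _ hax haz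
    · have := hxe p
      have := hz1 p hp
      omega
    · have := hxe p'
      have := hz1 p' hp'
      omega
  have choose1 : ∀ x ∈ A, ∀ y ∈ A, ∃ p, ∀ r, r ≠ p → ¬ (x r : ℕ) < y r := by
    intro x hx y hy
    by_cases hex : ∃ p, (x p : ℕ) < y p
    · obtain ⟨p, hp⟩ := hex
      exact ⟨p, fun r hr h => hr (key x hx y hy r p h hp)⟩
    · push Not at hex
      exact ⟨⟨0, hN⟩, fun r _ => not_lt.2 (hex r)⟩
  obtain ⟨p, hp⟩ := choose1 x hx y hy
  obtain ⟨p', hp'⟩ := choose1 y hy x hx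
  refine ⟨p, p', fun r h1 h2 => Fin.ext ?_⟩
  have := hp r h1
  have := hp' r h2
  omega

end Bridge

/-! ### Few edges: Hamiltonian cycles -/

section Hamiltonian

variable {V n ℓ N E M B : ℕ}

/-- The paths `2s`, `2s + 1`, `3n + s`, `2n + s` for `s < n`. For `s = 0`, the labels from `4n` on are
inserted between `3n` and `2n`. The value at the last vertices `2n + s` is irrelevant. -/
def pathNext (V n a : ℕ) : ℕ :=
  if a < 2 * n then (if a % 2 = 0 then a + 1 else 3 * n + a / 2)
  else if a < 3 * n then 0
  else if a = 3 * n then 4 * n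
  else if a < 4 * n then a - n
  else if a + 1 = V then 2 * n
  else a + 1

theorem pathNext_lt (hV : V = 4 * n + ℓ) (hℓ : 1 ≤ ℓ) (hn : 2 ≤ n) {a : ℕ} (ha : a < V) :
    pathNext V n a < V := by
  unfold pathNext
  split_ifs <;> omega

/-- The last vertices of the paths. -/
def pathEnd (hV : V = 4 * n + ℓ) (p : Fin n) : Fin V := ⟨2 * n + p, by omega⟩

/-- The paths through all vertices, joined by edges from `2n + s` to `2 * σ s`. -/
def hamCycle (hV : V = 4 * n + ℓ) (hℓ : 1 ≤ ℓ) (hn : 2 ≤ n) (σ : Equiv.Perm (Fin n)) (v : Fin V) :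
    Fin V :=
  if h : 2 * n ≤ (v : ℕ) ∧ (v : ℕ) < 3 * n then
    ⟨2 * σ ⟨v - 2 * n, by omega⟩, by have := (σ ⟨v - 2 * n, by omega⟩).2; omega⟩
  else ⟨pathNext V n v, pathNext_lt hV hℓ hn v.2⟩

/-- The edges of the paths. -/
def pathCore (hV : V = 4 * n + ℓ) (hℓ : 1 ≤ ℓ) (hn : 2 ≤ n) : Finset (Sym2 (Fin V)) :=
  (Finset.univ \ Finset.univ.image (pathEnd hV)).image fun v =>
    s(v, ⟨pathNext V n v, pathNext_lt hV hℓ hn v.2⟩)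

/-- The vertices that carry the additional edges: the labels from `4n` on. -/
def extraSide (V n : ℕ) : Finset (Fin V) :=
  Finset.univ.filter fun v => 4 * n ≤ (v : ℕ)

/-- The edges in `K` are those of the paths and some edges inside `extraSide`. -/
structure IsPathFrame (hV : V = 4 * n + ℓ) (hℓ : 1 ≤ ℓ) (hn : 2 ≤ n) (K : Finset (Sym2 (Fin V))) :
    Prop where
  core : pathCore hV hℓ hn ⊆ K
  le : K ⊆ pathCore hV hℓ hn ∪ (extraSide V n).offDiag.image (Function.uncurry Sym2.mk)

theorem pathEnd_injective (hV : V = 4 * n + ℓ) : Function.Injective (pathEnd hV) := fun p p' h => by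
  have := congrArg Fin.val h
  simp only [pathEnd] at this
  exact Fin.ext (by omega)

theorem card_extraSide (hV : V = 4 * n + ℓ) : (extraSide V n).card = ℓ := by
  have h1 : (extraSide V n).map Fin.valEmbedding = Finset.Ico (4 * n) (4 * n + ℓ) := by
    ext a
    simp only [extraSide, Finset.mem_map, Finset.mem_filter, Finset.mem_univ, true_and,
      Fin.valEmbedding_apply, Finset.mem_Ico]
    constructor
    · rintro ⟨v, hv, rfl⟩
      omega
    · intro ha
      exact ⟨⟨a, by omega⟩, ha.1, rfl⟩
  rw [← Finset.card_map Fin.valEmbedding, h1, Nat.card_Ico]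
  omega

theorem exists_isPathFrame (hV : V = 4 * n + ℓ) (hℓ : 1 ≤ ℓ) (hn : 2 ≤ n) {m : ℕ}
    (h1 : V ≤ m + n) (h2 : m ≤ ℓ.choose 2) : ∃ K, IsPathFrame hV hℓ hn K ∧ K.card = m := by
  have h3 : (pathCore hV hℓ hn).card ≤ m := by
    refine Finset.card_image_le.trans ?_
    rw [Finset.card_sdiff_of_subset (Finset.subset_univ _),
      Finset.card_image_of_injective _ (pathEnd_injective hV)]
    simp only [Finset.card_univ, Fintype.card_fin]
    omega
  have h4 : m ≤ (pathCore hV hℓ hn ∪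
      (extraSide V n).offDiag.image (Function.uncurry Sym2.mk)).card := by
    have h5 := Sym2.card_image_offDiag (extraSide V n)
    rw [card_extraSide hV] at h5
    exact h2.trans (h5.symm.le.trans (Finset.card_le_card Finset.subset_union_right))
  obtain ⟨K, hK1, hK2, hK3⟩ :=
    Finset.exists_subsuperset_card_eq Finset.subset_union_left h3 h4
  exact ⟨K, ⟨hK1, hK2⟩, hK3⟩

/-- The endpoints given by a permutation. -/
def permLabel (hV : V = 4 * n + ℓ) (σ : Equiv.Perm (Fin n)) (p : Fin n) : Fin V :=
  ⟨2 * σ p, by have := (σ p).2; omega⟩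

theorem permLabel_lt (hV : V = 4 * n + ℓ) (σ : Equiv.Perm (Fin n)) (p : Fin n) :
    (permLabel hV σ p : ℕ) < 2 * n := by
  have := (σ p).2
  simp only [permLabel]
  omega

theorem permLabel_injective (hV : V = 4 * n + ℓ) (σ : Equiv.Perm (Fin n)) :
    Function.Injective (permLabel hV σ) := fun p p' h => by
  have := congrArg Fin.val h
  simp only [permLabel] at this
  exact σ.injective (Fin.ext (by omega))

variable {hV : V = 4 * n + ℓ} {hℓ : 1 ≤ ℓ} {hn : 2 ≤ n} {K : Finset (Sym2 (Fin V))}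

theorem mem_pathCore {v : Fin V} (hv : ¬ (2 * n ≤ (v : ℕ) ∧ (v : ℕ) < 3 * n)) :
    s(v, ⟨pathNext V n v, pathNext_lt hV hℓ hn v.2⟩) ∈ pathCore hV hℓ hn := by
  refine Finset.mem_image_of_mem _ (Finset.mem_sdiff.2 ⟨Finset.mem_univ _, fun h => hv ?_⟩)
  obtain ⟨p, -, rfl⟩ := Finset.mem_image.1 h
  simp only [pathEnd]
  omega

theorem IsPathFrame.cases (hK : IsPathFrame hV hℓ hn K) {e : Sym2 (Fin V)} (he : e ∈ K) :
    ∃ a b : Fin V, e = s(a, b) ∧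
      ((¬ (2 * n ≤ (a : ℕ) ∧ (a : ℕ) < 3 * n) ∧ (b : ℕ) = pathNext V n a) ∨
        (a ≠ b ∧ 4 * n ≤ (a : ℕ) ∧ 4 * n ≤ (b : ℕ))) := by
  rcases Finset.mem_union.1 (hK.le he) with h | h
  · obtain ⟨v, hv, rfl⟩ := Finset.mem_image.1 h
    refine ⟨_, _, rfl, Or.inl ⟨fun h => (Finset.mem_sdiff.1 hv).2 ?_, rfl⟩⟩
    refine Finset.mem_image.2 ⟨⟨v - 2 * n, by omega⟩, Finset.mem_univ _, Fin.ext ?_⟩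
    simp only [pathEnd]
    omega
  · obtain ⟨⟨a, b⟩, hab, rfl⟩ := Finset.mem_image.1 h
    rw [Finset.mem_offDiag] at hab
    simp only [extraSide, Finset.mem_filter, Finset.mem_univ, true_and] at hab
    exact ⟨a, b, rfl, Or.inr ⟨hab.2.2, hab.1, hab.2.1⟩⟩

theorem IsPathFrame.not_isDiag (hK : IsPathFrame hV hℓ hn K) : ∀ e ∈ K, ¬ e.IsDiag := by
  intro e he
  obtain ⟨a, b, rfl, h⟩ := hK.cases he
  intro hab
  rw [Sym2.mk_isDiag_iff] at hab
  subst hab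
  unfold pathNext at h
  split_ifs at h <;> omega

/-- No edge of the frame joins the end of a path to a label below `2n`. -/
theorem IsPathFrame.isSimpleListing (hK : IsPathFrame hV hℓ hn K) {x : Fin n → Fin V}
    (hx : ∀ p, (x p : ℕ) < 2 * n) : IsSimpleListing K (pathEnd hV) x where
  inj p p' h := by
    rcases Sym2.eq_iff.1 h with ⟨h5, -⟩ | ⟨h5, -⟩
    · exact pathEnd_injective hV h5
    · have := congrArg Fin.val h5
      have := hx p'
      simp only [pathEnd] at *
      omega
  notMem p h := by
    have h2 := hx p
    have h1 : (pathEnd hV p : ℕ) = 2 * n + p := rfl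
    have h3 := p.2
    obtain ⟨a, b, hab, h⟩ := hK.cases h
    unfold pathNext at h
    rcases Sym2.eq_iff.1 hab with ⟨h5, h6⟩ | ⟨h5, h6⟩ <;> rw [h5] at h1 <;> rw [h6] at h2 <;>
      split_ifs at h <;> omega
  ne p h := by
    have := congrArg Fin.val h
    have := hx p
    simp only [pathEnd] at *
    omega

/-- If `σ` is a cycle through all of `Fin n`, then a nonempty set closed under `hamCycle` contains
all vertices. -/
theorem mem_of_hamCycle_closed {σ : Equiv.Perm (Fin n)} (hσ : σ.IsCycle)
    (hfix : ∀ p, σ p ≠ p) {S : Finset (Fin V)} (hS : ∀ v ∈ S, hamCycle hV hℓ hn σ v ∈ S)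
    (hne : S.Nonempty) (v : Fin V) : v ∈ S := by
  let Q : ℕ → Prop := fun a => ∃ h : a < V, (⟨a, h⟩ : Fin V) ∈ S
  have step : ∀ a b, Q a → ¬ (2 * n ≤ a ∧ a < 3 * n) → pathNext V n a = b → Q b := by
    rintro a _ ⟨h, ha⟩ h1 rfl
    have h2 := hS _ ha
    rw [hamCycle, dif_neg h1] at h2
    exact ⟨_, h2⟩
  have jump : ∀ p : Fin n, Q (2 * n + p) → Q (2 * σ p) := by
    rintro p ⟨h, ha⟩
    have h2 := hS _ ha
    rw [hamCycle, dif_pos (by simp only; omega)] at h2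
    have h3 : (⟨2 * n + (p : ℕ) - 2 * n, by omega⟩ : Fin n) = p := Fin.ext (by simp only; omega)
    simp only [h3] at h2
    exact ⟨_, h2⟩
  have extra : ∀ k a, a + k = V → 4 * n ≤ a → Q a → Q (2 * n) := by
    intro k
    induction k with
    | zero =>
      intro a hak _ hQ
      have := hQ.1
      omega
    | succ k ih =>
      intro a hak ha hQ
      by_cases h1 : a + 1 = V
      · exact step a _ hQ (by omega) (by unfold pathNext; split_ifs <;> omega)
      · exact ih (a + 1) (by omega) (by omega)
          (step a _ hQ (by omega) (by unfold pathNext; split_ifs <;> omega))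
  have extra' : Q (4 * n) → ∀ k, 4 * n + k < V → Q (4 * n + k) := by
    intro h k
    induction k with
    | zero => exact fun _ => h
    | succ k ih =>
      intro hk
      exact step (4 * n + k) _ (ih (by omega)) (by omega)
        (by unfold pathNext; split_ifs <;> omega)
  have first : ∀ p : Fin n, Q (2 * p) → Q (2 * p + 1) := fun p h =>
    step _ _ h (by omega) (by unfold pathNext; split_ifs <;> omega)
  have second : ∀ p : Fin n, Q (2 * p + 1) → Q (3 * n + p) := fun p h =>
    step _ _ h (by omega) (by unfold pathNext; split_ifs <;> omega)
  have zeroth : Q (3 * n) → Q (4 * n) := fun h =>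
    step _ _ h (by omega) (by unfold pathNext; split_ifs <;> omega)
  have third : ∀ p : Fin n, Q (3 * n + p) → Q (2 * n + p) := by
    intro p h
    by_cases hp : (p : ℕ) = 0
    · rw [hp] at h ⊢
      exact extra (V - 4 * n) (4 * n) (by omega) le_rfl (zeroth h)
    · exact step _ _ h (by omega) (by unfold pathNext; split_ifs <;> omega)
  obtain ⟨p₀, hp₀⟩ : ∃ p : Fin n, Q (2 * n + p) := by
    obtain ⟨w, hw⟩ := hne
    have hQw : Q w := ⟨w.2, hw⟩
    have hw2 := w.2
    by_cases h1 : (w : ℕ) < 2 * n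
    · let p : Fin n := ⟨w / 2, by omega⟩
      refine ⟨p, third p (second p ?_)⟩
      by_cases h2 : (w : ℕ) % 2 = 0
      · refine first p ?_
        have : 2 * (p : ℕ) = w := by simp only [p]; omega
        rwa [this]
      · have : 2 * (p : ℕ) + 1 = w := by simp only [p]; omega
        rwa [this]
    · by_cases h2 : (w : ℕ) < 3 * n
      · refine ⟨⟨w - 2 * n, by omega⟩, ?_⟩
        have : 2 * n + ((w : ℕ) - 2 * n) = w := by omega
        simpa only [this] using hQw
      · by_cases h3 : (w : ℕ) < 4 * n
        · refine ⟨⟨w - 3 * n, by omega⟩, third _ ?_⟩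
          have : 3 * n + ((w : ℕ) - 3 * n) = w := by omega
          simpa only [this] using hQw
        · exact ⟨⟨0, by omega⟩, extra (V - w) w (by omega) (by omega) hQw⟩
  have iter : ∀ i : ℕ, Q (2 * ((σ ^ i) (σ p₀) : Fin n)) := by
    intro i
    induction i with
    | zero => simpa using jump p₀ hp₀
    | succ i ih =>
      rw [pow_succ', Equiv.Perm.mul_apply]
      exact jump _ (third _ (second _ (first _ ih)))
  have all : ∀ p : Fin n, Q (2 * p) := by
    intro p
    obtain ⟨i, hi⟩ := hσ.exists_pow_eq (hfix (σ p₀)) (hfix p)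
    rw [← hi]
    exact iter i
  have hv := v.2
  suffices h : Q v from h.2
  by_cases h1 : (v : ℕ) < 2 * n
  · let p : Fin n := ⟨v / 2, by omega⟩
    by_cases h2 : (v : ℕ) % 2 = 0
    · have : 2 * (p : ℕ) = v := by simp only [p]; omega
      rw [← this]
      exact all p
    · have : 2 * (p : ℕ) + 1 = v := by simp only [p]; omega
      rw [← this]
      exact first p (all p)
  · by_cases h2 : (v : ℕ) < 3 * n
    · let p : Fin n := ⟨v - 2 * n, by omega⟩
      have : 2 * n + (p : ℕ) = v := by simp only [p]; omega
      rw [← this]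
      exact third p (second p (first p (all p)))
    · by_cases h3 : (v : ℕ) < 4 * n
      · let p : Fin n := ⟨v - 3 * n, by omega⟩
        have : 3 * n + (p : ℕ) = v := by simp only [p]; omega
        rw [← this]
        exact second p (first p (all p))
      · have : 4 * n + ((v : ℕ) - 4 * n) = v := by omega
        rw [← this]
        refine extra' (zeroth ?_) _ (by omega)
        let p : Fin n := ⟨0, by omega⟩
        exact second p (first p (all p))

theorem pathNext_cases (V n : ℕ) {a : ℕ} (ha : ¬ (2 * n ≤ a ∧ a < 3 * n)) :
    (a < 2 * n ∧ a % 2 = 0 ∧ pathNext V n a = a + 1) ∨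
      (a < 2 * n ∧ a % 2 = 1 ∧ pathNext V n a = 3 * n + a / 2) ∨
      (a = 3 * n ∧ pathNext V n a = 4 * n) ∨
      (3 * n < a ∧ a < 4 * n ∧ pathNext V n a + n = a) ∨
      (4 * n ≤ a ∧ a + 1 = V ∧ pathNext V n a = 2 * n) ∨
      (4 * n ≤ a ∧ pathNext V n a = a + 1) := by
  unfold pathNext
  split_ifs <;> omega

theorem hamCycle_hamCycle_ne (σ : Equiv.Perm (Fin n)) (v : Fin V) :
    hamCycle hV hℓ hn σ (hamCycle hV hℓ hn σ v) ≠ v := by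
  have key : ∀ v : Fin V, (2 * n ≤ (v : ℕ) ∧ (v : ℕ) < 3 * n ∧
      (hamCycle hV hℓ hn σ v : ℕ) < 2 * n ∧ (hamCycle hV hℓ hn σ v : ℕ) % 2 = 0) ∨
      (¬ (2 * n ≤ (v : ℕ) ∧ (v : ℕ) < 3 * n) ∧
        (hamCycle hV hℓ hn σ v : ℕ) = pathNext V n v) := by
    intro v
    by_cases h1 : 2 * n ≤ (v : ℕ) ∧ (v : ℕ) < 3 * n
    · refine Or.inl ⟨h1.1, h1.2, ?_⟩
      rw [hamCycle, dif_pos h1]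
      have := (σ ⟨v - 2 * n, by omega⟩).2
      simp only
      omega
    · exact Or.inr ⟨h1, by rw [hamCycle, dif_neg h1]⟩
  intro h
  have h3 := congrArg Fin.val h
  have h1 := key v
  have h2 := key (hamCycle hV hℓ hn σ v)
  generalize hamCycle hV hℓ hn σ (hamCycle hV hℓ hn σ v) = c at h1 h2 h3
  generalize hamCycle hV hℓ hn σ v = b at h1 h2 h3
  have hv := v.2
  rcases h1 with h1 | ⟨h1, h1'⟩ <;> rcases h2 with h2 | ⟨h2, h2'⟩
  · omega
  · have := pathNext_cases V n h2
    omega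
  · have := pathNext_cases V n h1
    omega
  · have h4 := pathNext_cases V n h1
    have h5 := pathNext_cases V n h2
    rw [← h1'] at h4
    rw [← h2', h3] at h5
    omega

theorem two_le_cutValue_of_isCycle (hK : IsPathFrame hV hℓ hn K) {σ : Equiv.Perm (Fin n)}
    (hσ : σ.IsCycle) (hfix : ∀ p, σ p ≠ p) {S : Finset (Fin V)} (hS : IsCut S) :
    2 ≤ cutValue (listedGraph K (pathEnd hV) (permLabel hV σ)) S := by
  have leave : ∀ S : Finset (Fin V), IsCut S → ∃ v ∈ S, hamCycle hV hℓ hn σ v ∉ S := by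
    intro S hS
    by_contra hcon
    push Not at hcon
    obtain ⟨b, hb⟩ := hS.2
    exact Finset.mem_compl.1 hb (mem_of_hamCycle_closed hσ hfix hcon hS.1 b)
  refine two_le_cutValue (hamCycle hV hℓ hn σ) (fun v h => ?_) (fun v => ?_) (leave S hS) ?_
  · exact hamCycle_hamCycle_ne σ v h
  · rw [mem_edgeSet_listedGraph hK.not_isDiag (hK.isSimpleListing (permLabel_lt hV σ)).ne]
    by_cases h1 : 2 * n ≤ (v : ℕ) ∧ (v : ℕ) < 3 * n
    · refine Or.inr ⟨⟨v - 2 * n, by omega⟩, ?_⟩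
      rw [hamCycle, dif_pos h1]
      have : pathEnd hV ⟨v - 2 * n, by omega⟩ = v := Fin.ext (by simp only [pathEnd]; omega)
      rw [this]
      rfl
    · rw [hamCycle, dif_neg h1]
      exact Or.inl (hK.core (mem_pathCore h1))
  · obtain ⟨v, hv, hcv⟩ := leave Sᶜ ⟨hS.2, by rw [compl_compl]; exact hS.1⟩
    exact ⟨v, Finset.mem_compl.1 hv, by simpa using hcv⟩

/-- Replacing the edge `f` by other edges loses at most one crossing edge; and if the value of the
cut drops, then `f` crosses it and no new edge does. -/
theorem cutValue_of_exchange {G G' : SimpleGraph (Fin V)} {f : Sym2 (Fin V)}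
    (h : ∀ e ∈ G.edgeSet, e ≠ f → e ∈ G'.edgeSet) (S : Finset (Fin V)) :
    cutValue G S ≤ cutValue G' S + 1 ∧ (cutValue G' S < cutValue G S →
      Crosses S f ∧ ∀ f' ∈ G'.edgeSet, f' ∉ G.edgeSet → ¬ Crosses S f') := by
  have hle : cutValue G S ≤ cutValue G' S + 1 := by
    refine (Set.ncard_le_ncard (t := insert f {e ∈ G'.edgeSet | Crosses S e}) ?_
      (Set.toFinite _)).trans (Set.ncard_insert_le _ _)
    rintro e ⟨he, hce⟩
    by_cases hef : e = f
    · exact Or.inl hef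
    · exact Or.inr ⟨h e he hef, hce⟩
  refine ⟨hle, fun hlt => ⟨?_, fun f' hf' hfG hcf => ?_⟩⟩
  · by_contra hcf
    refine absurd (Set.ncard_le_ncard (s := {e ∈ G.edgeSet | Crosses S e})
      (t := {e ∈ G'.edgeSet | Crosses S e}) ?_ (Set.toFinite _)) (not_le.2 hlt)
    rintro e ⟨he, hce⟩
    exact ⟨h e he fun hef => hcf (hef ▸ hce), hce⟩
  · have h1 : ({e ∈ G.edgeSet | Crosses S e} \ {f}).ncard < cutValue G' S := by
      refine Set.ncard_lt_ncard ⟨?_, fun hsub => ?_⟩ (Set.toFinite _)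
      · rintro e ⟨⟨he, hce⟩, hef⟩
        exact ⟨h e he hef, hce⟩
      · exact hfG (hsub ⟨hf', hcf⟩).1.1
    have h2 : cutValue G S ≤ ({e ∈ G.edgeSet | Crosses S e} \ {f}).ncard + 1 := by
      have h3 := Set.ncard_le_ncard_sdiff_add_ncard {e ∈ G.edgeSet | Crosses S e} {f}
      rw [Set.ncard_singleton] at h3
      exact h3
    omega

/-- Moving the endpoint of the unknown edge at `p` to another label `b` keeps all labels in range and
all other edges. -/
theorem moved_mem {x : Fin n → Fin V} (hK : IsPathFrame hV hℓ hn K)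
    (hx : ∀ p, (x p : ℕ) < 2 * n) (p : Fin n) {b : Fin V} (hb : (b : ℕ) < 2 * n) :
    (∀ r, (Function.update x p b r : ℕ) < 2 * n) ∧
      ∀ e ∈ (listedGraph K (pathEnd hV) x).edgeSet, e ≠ s(pathEnd hV p, x p) →
        e ∈ (listedGraph K (pathEnd hV) (Function.update x p b)).edgeSet := by
  have h1 : ∀ r, (Function.update x p b r : ℕ) < 2 * n := by
    intro r
    by_cases hr : r = p
    · subst hr
      simpa using hb
    · rw [Function.update_of_ne hr]
      exact hx r
  refine ⟨h1, fun e he hep => ?_⟩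
  rw [mem_edgeSet_listedGraph hK.not_isDiag (hK.isSimpleListing hx).ne] at he
  rw [mem_edgeSet_listedGraph hK.not_isDiag (hK.isSimpleListing h1).ne]
  rcases he with he | ⟨r, rfl⟩
  · exact Or.inl he
  · refine Or.inr ⟨r, ?_⟩
    rw [Function.update_of_ne]
    rintro rfl
    exact hep rfl

/-- After the unknown edge at the even label `2 * σ p` has been moved elsewhere, this vertex has
degree one. -/
theorem cutValue_moved_le (hK : IsPathFrame hV hℓ hn K) (σ : Equiv.Perm (Fin n)) (p : Fin n)
    {b : Fin V} (hb : (b : ℕ) < 2 * n) (hbp : b ≠ permLabel hV σ p) :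
    cutValue (listedGraph K (pathEnd hV) (Function.update (permLabel hV σ) p b))
      {permLabel hV σ p} ≤ 1 := by
  have h1 := (moved_mem hK (permLabel_lt hV σ) p hb).1
  have hlt := permLabel_lt hV σ p
  refine cutValue_le {s(permLabel hV σ p, ⟨permLabel hV σ p + 1, by omega⟩)} fun e he hce => ?_
  rw [mem_edgeSet_listedGraph hK.not_isDiag (hK.isSimpleListing h1).ne] at he
  have hev : (permLabel hV σ p : ℕ) % 2 = 0 := by simp [permLabel]
  rcases he with he | ⟨r, rfl⟩
  · obtain ⟨a, b, rfl, h⟩ := hK.cases he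
    rw [crosses_mk, Finset.mem_singleton, Finset.mem_singleton, Fin.ext_iff, Fin.ext_iff] at hce
    simp only [Finset.mem_singleton, Sym2.eq_iff, Fin.ext_iff]
    unfold pathNext at h
    split_ifs at h <;> omega
  · exfalso
    rw [crosses_mk, Finset.mem_singleton, Finset.mem_singleton] at hce
    have h2 : pathEnd hV r ≠ permLabel hV σ p := fun h => by
      have := congrArg Fin.val h
      simp only [pathEnd] at this
      omega
    by_cases hr : r = p
    · subst hr
      simp [h2, hbp] at hce
    · have h3 : permLabel hV σ r ≠ permLabel hV σ p := fun h => hr (permLabel_injective hV σ h)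
      simp [h2, Function.update_of_ne hr, h3] at hce

theorem connected_moved (hK : IsPathFrame hV hℓ hn K) {σ : Equiv.Perm (Fin n)}
    (hσ : σ.IsCycle) (hfix : ∀ p, σ p ≠ p) (p : Fin n) {b : Fin V} (hb : (b : ℕ) < 2 * n) :
    (listedGraph K (pathEnd hV) (Function.update (permLabel hV σ) p b)).Connected := by
  refine connected_of_cutValue_pos (by omega) fun S hS => ?_
  have h1 := two_le_cutValue_of_isCycle hK hσ hfix hS
  have h2 := (cutValue_of_exchange (moved_mem hK (permLabel_lt hV σ) p hb).2 S).1
  omega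

/-- A Hamiltonian cycle, the same graph with one edge moved up, and the same graph with another edge
moved down have no common answer. For a common minimum cut of the three graphs, both moved edges
would cross, and so would the edge `2s`, `2s + 1` between the old and the new endpoint of one of
them; but a cut with three crossing edges has value at least two after the move. -/
theorem no_common_answer_of_hamCycle {α : Type} {Ans : SimpleGraph (Fin V) → α → Prop}
    (hAns : IsMinCutAnswer Ans) (hK : IsPathFrame hV hℓ hn K) {σ : Equiv.Perm (Fin n)}
    (hσ : σ.IsCycle) (hfix : ∀ p, σ p ≠ p) {p p' : Fin n} (hp : p ≠ p') {b b' : Fin V}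
    (hb : (b : ℕ) = permLabel hV σ p + 1) (hb' : (b' : ℕ) + 1 = permLabel hV σ p') (a : α)
    (h0 : Ans (listedGraph K (pathEnd hV) (permLabel hV σ)) a)
    (h1 : Ans (listedGraph K (pathEnd hV) (Function.update (permLabel hV σ) p b)) a)
    (h2 : Ans (listedGraph K (pathEnd hV) (Function.update (permLabel hV σ) p' b')) a) : False := by
  have hlt := permLabel_lt hV σ p
  have hlt' := permLabel_lt hV σ p'
  have hev : (permLabel hV σ p : ℕ) % 2 = 0 := by simp [permLabel]
  have hb2 : (b : ℕ) < 2 * n := by omega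
  have hb2' : (b' : ℕ) < 2 * n := by omega
  have hs := hK.isSimpleListing (permLabel_lt hV σ)
  have hm := moved_mem hK (permLabel_lt hV σ) p hb2
  have hm' := moved_mem hK (permLabel_lt hV σ) p' hb2'
  have hcut : ∀ v : Fin V, IsCut {v} := fun v => by
    refine ⟨Finset.singleton_nonempty _, Finset.card_pos.1 ?_⟩
    rw [Finset.card_compl, Finset.card_singleton, Fintype.card_fin]
    omega
  have hone := cutValue_moved_le hK σ p hb2 fun h => by rw [h] at hb; omega
  have hone' := cutValue_moved_le hK σ p' hb2' fun h => by rw [h] at hb'; omega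
  refine hAns {listedGraph K (pathEnd hV) (permLabel hV σ),
    listedGraph K (pathEnd hV) (Function.update (permLabel hV σ) p b),
    listedGraph K (pathEnd hV) (Function.update (permLabel hV σ) p' b')} ?_ ?_ ⟨a, ?_⟩
  · rintro ⟨c, hc⟩
    obtain ⟨S, hS, hSc⟩ := hc _ (Set.mem_insert _ _)
    obtain ⟨S', hS', hSc'⟩ := hc (listedGraph K (pathEnd hV)
      (Function.update (permLabel hV σ) p b)) (by simp)
    have h3 := two_le_cutValue_of_isCycle hK hσ hfix hS.1
    have h4 := hS'.2 _ (hcut (permLabel hV σ p))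
    omega
  · rintro ⟨S, hS⟩
    have hS0 := hS _ (Set.mem_insert _ _)
    have hS1 := hS (listedGraph K (pathEnd hV) (Function.update (permLabel hV σ) p b)) (by simp)
    have hS2 := hS (listedGraph K (pathEnd hV) (Function.update (permLabel hV σ) p' b')) (by simp)
    have h3 := two_le_cutValue_of_isCycle hK hσ hfix hS0.1
    have h4 := hS1.2 _ (hcut (permLabel hV σ p))
    have h5 := hS2.2 _ (hcut (permLabel hV σ p'))
    obtain ⟨h6, h7⟩ := cutValue_of_exchange hm.2 S
    obtain ⟨hc, hnc⟩ := h7 (by omega)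
    obtain ⟨-, h8⟩ := cutValue_of_exchange hm'.2 S
    obtain ⟨hc', -⟩ := h8 (by omega)
    have hnew : ¬ Crosses S s(pathEnd hV p, b) := by
      refine hnc _ ?_ ?_
      · rw [mem_edgeSet_listedGraph hK.not_isDiag (hK.isSimpleListing hm.1).ne]
        exact Or.inr ⟨p, by simp⟩
      · rw [mem_edgeSet_listedGraph hK.not_isDiag hs.ne]
        have hsb := (hK.isSimpleListing hm.1).notMem p
        rw [Function.update_self] at hsb
        rintro (h | ⟨r, hr⟩)
        · exact hsb h
        · have hr2 := permLabel_lt hV σ r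
          have hr3 : (permLabel hV σ r : ℕ) % 2 = 0 := by simp [permLabel]
          rcases Sym2.eq_iff.1 hr with ⟨-, h⟩ | ⟨-, h⟩
          · have := congrArg Fin.val h
            omega
          · have := congrArg Fin.val h
            simp only [pathEnd] at this
            omega
    have hgap : s(permLabel hV σ p, b) ∈ (listedGraph K (pathEnd hV) (permLabel hV σ)).edgeSet := by
      rw [mem_edgeSet_listedGraph hK.not_isDiag hs.ne]
      have h9 := hK.core (mem_pathCore (v := permLabel hV σ p) (by omega))
      have h10 : (⟨pathNext V n (permLabel hV σ p), pathNext_lt hV hℓ hn (permLabel hV σ p).2⟩ :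
          Fin V) = b := Fin.ext (by simp only [pathNext, if_pos hlt, if_pos hev, hb])
      rw [h10] at h9
      exact Or.inl h9
    have hcgap : Crosses S s(permLabel hV σ p, b) := by
      rw [crosses_mk] at hc hnew ⊢
      tauto
    have hmemp : ∀ r, s(pathEnd hV r, permLabel hV σ r) ∈
        (listedGraph K (pathEnd hV) (permLabel hV σ)).edgeSet := fun r => by
      rw [mem_edgeSet_listedGraph hK.not_isDiag hs.ne]
      exact Or.inr ⟨r, rfl⟩
    have hne : ∀ r, s(pathEnd hV r, permLabel hV σ r) ≠ s(permLabel hV σ p, b) := by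
      intro r h
      rcases Sym2.eq_iff.1 h with ⟨h, -⟩ | ⟨h, -⟩ <;>
      · have := congrArg Fin.val h
        simp only [pathEnd] at this
        omega
    have hthree := le_cutValue (G := listedGraph K (pathEnd hV) (permLabel hV σ)) (S := S)
      {s(pathEnd hV p, permLabel hV σ p), s(pathEnd hV p', permLabel hV σ p'),
        s(permLabel hV σ p, b)} (by
      intro e he
      simp only [Finset.mem_insert, Finset.mem_singleton] at he
      rcases he with rfl | rfl | rfl
      · exact ⟨hmemp p, hc⟩
      · exact ⟨hmemp p', hc'⟩
      · exact ⟨hgap, hcgap⟩)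
    rw [Finset.card_eq_three.2 ⟨_, _, _, fun h => hp (hs.inj h), hne p, hne p', rfl⟩] at hthree
    omega
  · rintro G (rfl | rfl | rfl)
    · exact h0
    · exact h1
    · exact h2

/-- A permutation that is pointwise at most another one is equal to it. -/
theorem perm_eq_of_le {σ τ : Equiv.Perm (Fin n)} (h : ∀ p, σ p ≤ τ p) : σ = τ := by
  have h1 : ∑ p, (σ p : ℕ) = ∑ p, (τ p : ℕ) := by
    rw [Equiv.sum_comp σ fun i : Fin n => (i : ℕ), Equiv.sum_comp τ fun i : Fin n => (i : ℕ)]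
  have h2 := (Finset.sum_eq_sum_iff_of_le fun p _ => Fin.le_def.1 (h p)).1 h1
  ext p
  exact h2 p (Finset.mem_univ p)

/-- The counting bound for graphs with few edges. -/
theorem card_le_of_hamCycle {α : Type} {Ans : SimpleGraph (Fin V) → α → Prop}
    (hAns : IsMinCutAnswer Ans) (hV : V = 4 * n + ℓ) (hℓ : 1 ≤ ℓ) (hn : 2 ≤ n)
    (hE1 : V ≤ E) (hE2 : E ≤ n + ℓ.choose 2) (hB : 1 ≤ B) (T : IOTree V M B α)
    (hT : ∀ (G : SimpleGraph (Fin V)) (e : Fin E → Fin V × Fin V), G.Connected → IsEdgeList G e →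
      Ans G (T.run (initialState M B e))) :
    (n - 1).factorial ≤
        ((V + 1) * (4 * M + 2 * B).choose (2 * B)) ^ T.depth * (5 * B) ^ n ∧
      (n - 1).factorial ≤
        ((V + 1) * ((4 * M + 2 * B).choose (2 * B) * (5 * B) ^ B)) ^ T.depth := by
  classical
  obtain ⟨K, hK, hKc⟩ := exists_isPathFrame hV hℓ hn (m := E - n) (by omega) (by omega)
  obtain ⟨k, hk1, hk2⟩ := exists_listing K hKc
  have hNE : n ≤ E := by omega
  let P : Finset (Equiv.Perm (Fin n)) := Finset.univ.filter fun σ => σ.cycleType = {n}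
  have hP : P.card = (n - 1).factorial := by
    have := Equiv.Perm.card_of_cycleType_singleton (α := Fin n) hn (by simp)
    simpa using this
  have hPc : ∀ σ ∈ P, σ.IsCycle ∧ ∀ p, σ p ≠ p := by
    intro σ hσ
    have h1 : σ.cycleType = {n} := (Finset.mem_filter.1 hσ).2
    refine ⟨Equiv.Perm.card_cycleType_eq_one.1 (by rw [h1]; rfl), fun p => ?_⟩
    have h2 : σ.support.card = n := by
      rw [← Equiv.Perm.sum_cycleType, h1, Multiset.sum_singleton]
    have h3 : σ.support = Finset.univ := Finset.eq_univ_of_card _ (by simpa using h2)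
    rw [← Equiv.Perm.mem_support, h3]
    exact Finset.mem_univ p
  have hinj : Function.Injective (permLabel hV) := fun σ τ h => by
    ext p
    have := congrArg Fin.val (congrFun h p)
    simp only [permLabel] at this
    omega
  rw [← hP, ← Finset.card_image_of_injective P hinj]
  have heven : ∀ x ∈ P.image (permLabel hV), ∀ p, (x p : ℕ) % 2 = 0 := by
    intro x hx p
    obtain ⟨σ, -, rfl⟩ := Finset.mem_image.1 hx
    simp [permLabel]
  have hmain := card_le_of_good hB hNE (pathEnd hV) k T (P.image (permLabel hV)) heven 1
    fun A hA hgood => ?_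
  · simpa only [one_mul] using hmain
  refine Finset.card_le_one.2 fun x hx y hy => ?_
  obtain ⟨σ, hσ, rfl⟩ := Finset.mem_image.1 (hA hx)
  obtain ⟨τ, hτ, rfl⟩ := Finset.mem_image.1 (hA hy)
  by_contra hne
  have hστ : σ ≠ τ := fun h => hne (by rw [h])
  obtain ⟨p, hp⟩ : ∃ p, σ p < τ p := by
    by_contra hcon
    push Not at hcon
    exact hστ (perm_eq_of_le hcon).symm
  obtain ⟨p', hp'⟩ : ∃ p, τ p < σ p := by
    by_contra hcon
    push Not at hcon
    exact hστ (perm_eq_of_le hcon)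
  have hpp : p ≠ p' := fun h => absurd (h ▸ hp) (not_lt.2 hp'.le)
  obtain ⟨hc, hfix⟩ := hPc σ hσ
  have hlt := permLabel_lt hV σ p
  have hlt' := permLabel_lt hV σ p'
  rw [Fin.lt_def] at hp hp'
  let b : Fin V := ⟨permLabel hV σ p + 1, by omega⟩
  let b' : Fin V := ⟨permLabel hV σ p' - 1, by omega⟩
  have hval : ∀ (ρ : Equiv.Perm (Fin n)) r, (permLabel hV ρ r : ℕ) = 2 * ρ r := fun _ _ => rfl
  have hb2 : (b : ℕ) < 2 * n := by
    have := (σ p).2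
    have := (τ p).2
    simp only [b, hval]
    omega
  have hb2' : (b' : ℕ) < 2 * n := by
    simp only [b']
    omega
  have hint : Interpolates (permLabel hV σ) (permLabel hV τ)
      (Function.update (permLabel hV σ) p b) := by
    refine ⟨fun r => ?_, fun r r' h1 _ => by rw [permLabel_injective hV σ h1]⟩
    by_cases hr : r = p
    · subst hr
      refine Or.inr (Or.inl ⟨?_, by simp [b]⟩)
      rw [hval, hval]
      omega
    · exact Or.inl (Function.update_of_ne hr _ _)
  have hint' : Interpolates (permLabel hV σ) (permLabel hV τ)
      (Function.update (permLabel hV σ) p' b') := by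
    refine ⟨fun r => ?_, fun r r' h1 _ => by rw [permLabel_injective hV σ h1]⟩
    by_cases hr : r = p'
    · subst hr
      refine Or.inr (Or.inr ⟨?_, ?_⟩)
      · rw [hval, hval]
        omega
      · rw [Function.update_self]
        simp only [b', hval]
        omega
    · exact Or.inl (Function.update_of_ne hr _ _)
  have hrun := hgood _ hx _ hy _ hint
  have hrun' := hgood _ hx _ hy _ hint'
  have hconn : (listedGraph K (pathEnd hV) (permLabel hV σ)).Connected := by
    refine connected_of_cutValue_pos (by omega) fun S hS => ?_
    have := two_le_cutValue_of_isCycle hK hc hfix hS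
    omega
  have h0 := hT _ _ hconn (isEdgeList_edgeListing hNE hK.not_isDiag
    (hK.isSimpleListing (permLabel_lt hV σ)) k hk1 hk2)
  have h1 := hT _ _ (connected_moved hK hc hfix p hb2) (isEdgeList_edgeListing hNE hK.not_isDiag
    (hK.isSimpleListing (moved_mem hK (permLabel_lt hV σ) p hb2).1) k hk1 hk2)
  have h2 := hT _ _ (connected_moved hK hc hfix p' hb2') (isEdgeList_edgeListing hNE hK.not_isDiag
    (hK.isSimpleListing (moved_mem hK (permLabel_lt hV σ) p' hb2').1) k hk1 hk2)
  rw [hrun] at h1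
  rw [hrun'] at h2
  refine no_common_answer_of_hamCycle hAns hK hc hfix hpp (b := b) (b' := b') rfl ?_ _ h0 h1 h2
  simp only [b', hval]
  omega

end Hamiltonian

/-! ### From counting to depth -/

theorem log_choose_le {M B : ℕ} (hB : 1 ≤ B) (hM : 2 * B ≤ M) :
    Real.log ((4 * M + 2 * B).choose (2 * B)) ≤ 10 * (B * Real.log ((M : ℝ) / B)) := by
  have hB0 : (0 : ℝ) < B := by exact_mod_cast hB
  have hMB : (2 : ℝ) * B ≤ M := by exact_mod_cast hM
  set μ := (M : ℝ) / B with hμ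
  have hμ2 : 2 ≤ μ := by rw [hμ, le_div_iff₀ hB0]; exact hMB
  have hM' : (M : ℝ) = μ * B := by rw [hμ]; field_simp
  have hpos : (0 : ℝ) < (4 * M + 2 * B).choose (2 * B) := by
    exact_mod_cast Nat.choose_pos (by omega)
  have h1 : ((4 * M + 2 * B).choose (2 * B) : ℝ) ≤ (Real.exp 1 * (2 * μ + 1)) ^ (2 * B) := by
    have h2 := Nat.choose_le_pow_div (α := ℝ) (2 * B) (4 * M + 2 * B)
    have h3 := Real.pow_div_factorial_le_exp ((2 * B : ℕ) : ℝ) (by positivity) (2 * B)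
    have h4 : (((4 * M + 2 * B : ℕ) : ℝ)) = ((2 * B : ℕ) : ℝ) * (2 * μ + 1) := by
      push_cast
      rw [hM']
      ring
    rw [h4, mul_pow] at h2
    calc _ ≤ _ := h2
      _ = ((2 * B : ℕ) : ℝ) ^ (2 * B) / ((2 * B).factorial : ℝ) * (2 * μ + 1) ^ (2 * B) := by ring
      _ ≤ Real.exp ((2 * B : ℕ) : ℝ) * (2 * μ + 1) ^ (2 * B) := by gcongr
      _ = _ := by rw [mul_pow, ← Real.exp_nat_mul, mul_one]
  have hlogμ : Real.log 2 ≤ Real.log μ := Real.log_le_log (by norm_num) hμ2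
  have hlog2 := Real.log_two_gt_d9
  have h5 : Real.log (2 * μ + 1) ≤ 3 * Real.log μ := by
    have h6 : 2 * 2 ≤ μ * μ := mul_le_mul hμ2 hμ2 (by norm_num) (by linarith)
    have h7 : 2 * 2 * μ ≤ μ * μ * μ := mul_le_mul_of_nonneg_right h6 (by linarith)
    have : Real.log (2 * μ + 1) ≤ Real.log (μ ^ 3) :=
      Real.log_le_log (by linarith) (by linarith [show μ ^ 3 = μ * μ * μ by ring])
    rwa [Real.log_pow] at this
  calc _ ≤ Real.log ((Real.exp 1 * (2 * μ + 1)) ^ (2 * B)) := Real.log_le_log hpos h1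
    _ = 2 * B * (1 + Real.log (2 * μ + 1)) := by
      rw [Real.log_pow, Real.log_mul (Real.exp_ne_zero _) (by linarith), Real.log_exp]
      push_cast
      ring
    _ ≤ 2 * B * (5 * Real.log μ) := by
      gcongr
      linarith
    _ = _ := by ring

/-- A counting bound in logarithmic form. The assumption on `log V` makes the cost `log (V + 1)` of an
indexed branching negligible against the cost `B * log (M / B)` of a merge. -/
theorem mul_log_le_of_pow_le {V M B D N : ℕ} {y : ℝ} (hy : 0 < y) (hV : 2 ≤ V) (hB : 1 ≤ B)
    (hM : 2 * B ≤ M) (hlog : Real.log V < (B : ℝ) * Real.log ((M : ℝ) / B)) (m : ℕ) (hm : 1 ≤ m)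
    (k : ℕ) (H : y ^ N ≤ (V : ℝ) ^ 6 *
      (((V + 1) * ((4 * M + 2 * B).choose (2 * B) * m) : ℕ) : ℝ) ^ D * ((5 * B : ℕ) : ℝ) ^ k) :
    N * Real.log y ≤ 6 * Real.log V +
      D * (12 * ((B : ℝ) * Real.log ((M : ℝ) / B)) + Real.log m) +
        k * (Real.log 5 + Real.log B) := by
  have hV2 : (2 : ℝ) ≤ V := by exact_mod_cast hV
  have hB0 : (0 : ℝ) < B := by exact_mod_cast hB
  have hm0 : (m : ℝ) ≠ 0 := by exact_mod_cast (by omega : m ≠ 0)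
  have hch0 : ((4 * M + 2 * B).choose (2 * B) : ℝ) ≠ 0 := by
    exact_mod_cast (Nat.choose_pos (by omega)).ne'
  have hch := log_choose_le hB hM
  have hV1 : Real.log ((V : ℝ) + 1) ≤ 2 * Real.log V := by
    have h1 : Real.log ((V : ℝ) + 1) ≤ Real.log ((V : ℝ) ^ 2) :=
      Real.log_le_log (by linarith) (by nlinarith)
    rw [Real.log_pow] at h1
    exact_mod_cast h1
  have hbase : (((V + 1) * ((4 * M + 2 * B).choose (2 * B) * m) : ℕ) : ℝ) ≠ 0 := by
    push_cast
    positivity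
  have h5B : ((5 * B : ℕ) : ℝ) ≠ 0 := by push_cast; positivity
  have h1 := Real.log_le_log (pow_pos hy N) H
  rw [Real.log_mul (mul_ne_zero (by positivity) (pow_ne_zero _ hbase)) (pow_ne_zero _ h5B),
    Real.log_mul (by positivity) (pow_ne_zero _ hbase), Real.log_pow, Real.log_pow, Real.log_pow,
    Real.log_pow] at h1
  have h2 : Real.log (((V + 1) * ((4 * M + 2 * B).choose (2 * B) * m) : ℕ) : ℝ) ≤
      12 * ((B : ℝ) * Real.log ((M : ℝ) / B)) + Real.log m := by
    rw [Nat.cast_mul, Nat.cast_mul, Nat.cast_add, Nat.cast_one,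
      Real.log_mul (by positivity) (mul_ne_zero hch0 hm0), Real.log_mul hch0 hm0]
    linarith
  have h3 : Real.log ((5 * B : ℕ) : ℝ) = Real.log 5 + Real.log B := by
    push_cast
    exact Real.log_mul (by norm_num) hB0.ne'
  have h4 := mul_le_mul_of_nonneg_left h2 (Nat.cast_nonneg (α := ℝ) D)
  rw [h3, show ((6 : ℕ) : ℝ) = 6 by norm_num] at h1
  linarith

/-- The lower bound on the depth `D` in terms of logarithms: `L` and `b` stand for `log V` and `log B`,
and `X` for `B * log (M / B)`. The first counting bound is used when `V / B` is large; the second one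
when `V / B` is bounded, where the claim only says that a constant fraction of the unknown edges has
to be read. -/
theorem depth_bound_of_log_bounds {α K₀ V E B N D L b l X : ℝ} (hα : 0 < α) (hK₀ : 1 ≤ K₀)
    (hD : 0 ≤ D) (hE : 0 ≤ E) (hb : 0 ≤ b) (hl : 0 ≤ l) (hlL : l ≤ L)
    (hVL : 24 * L ≤ α * V) (hKL : 2 * K₀ ≤ L) (hN : α * E ≤ N)
    (hNV : α * V ≤ N) (hLX : L ≤ X) (hBX : B ≤ 2 * X) (I1 : N * (L - b - K₀) ≤ 6 * L + D * (12 * X))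
    (I2 : N * (L - K₀) ≤ 6 * L + D * (12 * X + B * (l + b))) :
    min (α / 48) (α / (128 * K₀)) * (E * (L - b)) ≤ D * X := by
  set r := L - b with hr
  have hN0 : 0 ≤ N := by linarith
  have hX0 : 0 ≤ X := by linarith
  have hL2 : 2 ≤ L := by linarith
  have hmin0 : 0 ≤ min (α / 48) (α / (128 * K₀)) := by positivity
  rcases le_total r 0 with hr0 | hr0
  · exact (mul_nonpos_of_nonneg_of_nonpos hmin0 (mul_nonpos_of_nonneg_of_nonpos hE hr0)).trans
      (mul_nonneg hD hX0)
  · have hEr : 0 ≤ E * r := mul_nonneg hE hr0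
    rcases le_total (2 * K₀) r with hr1 | hr1
    · refine (mul_le_mul_of_nonneg_right (min_le_left _ _) hEr).trans ?_
      have h1 : N * (r / 2) ≤ N * (r - K₀) := mul_le_mul_of_nonneg_left (by linarith) hN0
      have h2 : N * 2 ≤ N * r := mul_le_mul_of_nonneg_left (by linarith) hN0
      have h3 : α * E * r ≤ N * r := mul_le_mul_of_nonneg_right hN hr0
      linarith
    · refine (mul_le_mul_of_nonneg_right (min_le_right _ _) hEr).trans ?_
      have h1 : N * (L / 2) ≤ N * (L - K₀) := mul_le_mul_of_nonneg_left (by linarith) hN0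
      have h2 : 24 * L ≤ N * L := mul_le_mul_of_nonneg_right (by linarith) (by linarith)
      have h3 : B * (l + b) ≤ 2 * X * (2 * L) :=
        mul_le_mul hBX (by linarith) (by linarith) (by linarith)
      have h4 : X * 2 ≤ X * L := mul_le_mul_of_nonneg_left hL2 hX0
      have h5 : D * (12 * X + B * (l + b)) ≤ D * (16 * (X * L)) :=
        mul_le_mul_of_nonneg_left (by linarith) hD
      have h6 : N * L ≤ 64 * (D * X) * L := by linarith
      have h7 : N ≤ 64 * (D * X) := le_of_mul_le_mul_right h6 (by linarith)
      have h8 : α / (128 * K₀) * (E * r) ≤ α / (128 * K₀) * (E * (2 * K₀)) := by gcongr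
      have h9 : α / (128 * K₀) * (E * (2 * K₀)) = α * E / 64 := by
        rw [div_mul_eq_mul_div, div_eq_div_iff (by positivity) (by norm_num)]
        ring
      linarith

/-- Both counting bounds together give the lower bound on the depth `D`. -/
theorem exists_depth_bound (α β : ℝ) (hα : 0 < α) (hβ : 0 < β) (hβ1 : β ≤ 1) :
    ∃ c : ℝ, 0 < c ∧ ∃ V₀ : ℕ, ∀ V E M B N n D : ℕ, V₀ ≤ V → V ≤ E → 1 ≤ B → 2 * B ≤ M →
      Real.log V < (B : ℝ) * Real.log ((M : ℝ) / B) → α * E ≤ N → β * V ≤ n →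
      ((n : ℝ) / 3) ^ N ≤ (V : ℝ) ^ 6 *
        (((V + 1) * (4 * M + 2 * B).choose (2 * B) : ℕ) : ℝ) ^ D * ((5 * B : ℕ) : ℝ) ^ N →
      ((n : ℝ) / 3) ^ N ≤ (V : ℝ) ^ 6 *
        (((V + 1) * ((4 * M + 2 * B).choose (2 * B) * (5 * B) ^ B) : ℕ) : ℝ) ^ D →
      c * ((E : ℝ) / V * sortBound M B V) ≤ D := by
  have hlog2 := Real.log_two_gt_d9
  set K₀ := Real.log (15 / β) with hK₀
  have hK₀1 : 1 ≤ K₀ := by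
    rw [hK₀, Real.le_log_iff_exp_le (by positivity)]
    have h1 := Real.exp_one_lt_d9
    have h2 : 15 ≤ 15 / β := by rw [le_div_iff₀ hβ]; linarith
    linarith
  have hev : ∀ᶠ x : ℝ in Filter.atTop,
      24 * Real.log x ≤ α * x ∧ 2 * K₀ ≤ Real.log x ∧ 5 ≤ x := by
    have h1 := Real.isLittleO_log_id_atTop.bound (c := α / 24) (by positivity)
    have h2 := Real.tendsto_log_atTop.eventually_ge_atTop (2 * K₀)
    filter_upwards [h1, h2, Filter.eventually_ge_atTop 5] with x hx1 hx2 hx3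
    rw [Real.norm_eq_abs, Real.norm_eq_abs, id, abs_of_nonneg (by linarith : (0:ℝ) ≤ x)] at hx1
    have h3 := le_abs_self (Real.log x)
    exact ⟨by linarith, hx2, hx3⟩
  obtain ⟨V₀, hV₀⟩ := Filter.eventually_atTop.1 (tendsto_natCast_atTop_atTop.eventually hev)
  refine ⟨min (α / 48) (α / (128 * K₀)), by positivity, V₀, ?_⟩
  intro V E M B N n D hV hVE hB hM hlog hN hn H1 H2
  obtain ⟨hb1, hb2, hb3⟩ := hV₀ V hV
  have hV2 : 2 ≤ V := by
    have : 5 ≤ V := by exact_mod_cast hb3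
    omega
  have hV0 : (0 : ℝ) < V := by linarith
  have hB0 : (0 : ℝ) < B := by exact_mod_cast hB
  have hB1 : (1 : ℝ) ≤ B := by exact_mod_cast hB
  have hE0 : (V : ℝ) ≤ E := by exact_mod_cast hVE
  have hn0 : (0 : ℝ) < (n : ℝ) / 3 := by
    have : 0 < β * V := by positivity
    linarith
  have hNV : α * V ≤ N := le_trans (by gcongr) hN
  have hμ2 : (2 : ℝ) ≤ (M : ℝ) / B := by
    rw [le_div_iff₀ hB0]
    exact_mod_cast hM
  have hlogμ : Real.log 2 ≤ Real.log ((M : ℝ) / B) := Real.log_le_log (by norm_num) hμ2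
  have hBL : (B : ℝ) ≤ 2 * (B * Real.log ((M : ℝ) / B)) := by
    have : (B : ℝ) * (1 / 2) ≤ B * Real.log ((M : ℝ) / B) :=
      mul_le_mul_of_nonneg_left (by linarith) hB0.le
    linarith
  have hlogn : Real.log V - K₀ + Real.log 5 ≤ Real.log ((n : ℝ) / 3) := by
    have h1 : Real.log (β * V / 3) ≤ Real.log ((n : ℝ) / 3) :=
      Real.log_le_log (by positivity) (by gcongr)
    have h2 : Real.log (β * V / 3) = Real.log V - K₀ + Real.log 5 := by
      rw [hK₀, ← Real.log_div (by positivity) (by positivity),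
        ← Real.log_mul (by positivity) (by norm_num)]
      congr 1
      field_simp
      norm_num
    linarith
  have hlog5 : 0 < Real.log 5 := Real.log_pos (by norm_num)
  have hNlog := mul_le_mul_of_nonneg_left hlogn (Nat.cast_nonneg (α := ℝ) N)
  have J1 := mul_log_le_of_pow_le (N := N) (D := D) hn0 hV2 hB hM hlog 1 le_rfl N (by rwa [mul_one])
  have J2 := mul_log_le_of_pow_le (N := N) (D := D) hn0 hV2 hB hM hlog ((5 * B) ^ B)
    (Nat.one_le_pow _ _ (by omega)) 0 (by rwa [pow_zero, mul_one])
  rw [Nat.cast_one, Real.log_one] at J1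
  have h5B : Real.log (((5 * B) ^ B : ℕ) : ℝ) = B * (Real.log 5 + Real.log B) := by
    push_cast
    rw [Real.log_pow, Real.log_mul (by norm_num) hB0.ne']
  rw [h5B] at J2
  push_cast at J2
  have hX0 : 0 < (B : ℝ) * Real.log ((M : ℝ) / B) := by linarith
  have hgoal : (E : ℝ) / V * sortBound M B V =
      E * (Real.log V - Real.log B) / (B * Real.log ((M : ℝ) / B)) := by
    rw [sortBound, Real.logb, Real.log_div hV0.ne' hB0.ne']
    field_simp
  rw [hgoal, ← mul_div_assoc, div_le_iff₀ hX0]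
  refine depth_bound_of_log_bounds hα hK₀1 (Nat.cast_nonneg D) (by linarith)
    (Real.log_nonneg hB1) hlog5.le (Real.log_le_log (by norm_num) hb3) hb1 hb2 hN hNV hlog.le
    hBL ?_ ?_
  · linarith
  · have : (N : ℝ) * 0 ≤ N * Real.log 5 := by gcongr
    linarith

theorem div_three_pow_le_factorial (n : ℕ) : ((n : ℝ) / 3) ^ n ≤ n.factorial := by
  have h1 := Real.pow_div_factorial_le_exp (n : ℝ) (Nat.cast_nonneg n) n
  have h2 : Real.exp n ≤ 3 ^ n := by
    rw [← mul_one (n : ℝ), Real.exp_nat_mul]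
    have := Real.exp_one_lt_d9
    exact pow_le_pow_left₀ (Real.exp_pos 1).le (by linarith) n
  have h3 : (0 : ℝ) < n.factorial := by exact_mod_cast n.factorial_pos
  rw [div_pow, div_le_iff₀ (by positivity), mul_comm]
  exact (div_le_iff₀ h3).1 (h1.trans h2)

/-- A constant fraction of the vertices can be set aside without losing the room for the edges. -/
theorem le_choose_two {ε : ℝ} (hε : 0 < ε) (hε1 : ε < 1) {V E k n : ℕ} (hkε : 16 ≤ k * ε)
    (hV : (8 : ℝ) * k ≤ V) (hnk : n * k ≤ V) (h16 : 16 * n ≤ V)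
    (hE : (E : ℝ) ≤ (1 - ε) * ((V : ℝ) * ((V : ℝ) - 1) / 2)) : E ≤ (V - 2 * n - 2).choose 2 := by
  have hnk' : (n : ℝ) * k ≤ V := by exact_mod_cast hnk
  have hV0 : (0 : ℝ) ≤ V := Nat.cast_nonneg V
  have hεV : 128 ≤ ε * V := by
    have := mul_le_mul_of_nonneg_left hV hε.le
    linarith
  have hV128 : 128 ≤ V := by
    have h1 : (128 : ℝ) ≤ V := hεV.trans (by
      have := mul_le_mul_of_nonneg_right hε1.le hV0
      linarith)
    exact_mod_cast h1
  have h16n : 16 * (n : ℝ) ≤ ε * V := by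
    have h1 := mul_le_mul_of_nonneg_left hkε (Nat.cast_nonneg (α := ℝ) n)
    have h2 := mul_le_mul_of_nonneg_left hnk' hε.le
    linarith
  have h1 : ((V - 2 * n - 2 : ℕ) : ℝ) = V - 2 * n - 2 := by
    rw [Nat.cast_sub (by omega), Nat.cast_sub (by omega)]
    push_cast
    ring
  have h2 : ((V - 2 * n - 2 - 1 : ℕ) : ℝ) = V - 2 * n - 3 := by
    rw [Nat.cast_sub (by omega), h1]
    push_cast
    ring
  have h4 : (1 - ε / 4) * V ≤ (V : ℝ) - 2 * n - 3 := by linarith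
  have h5 : 0 ≤ (1 - ε / 4) * (V : ℝ) := mul_nonneg (by linarith) hV0
  have h6 : ((1 - ε / 4) * (V : ℝ)) * ((1 - ε / 4) * V) ≤ (V - 2 * n - 2) * (V - 2 * n - 3) :=
    mul_le_mul (by linarith) h4 h5 (by linarith)
  have h7 : (1 - ε) * ((V : ℝ) * V) ≤ ((1 - ε / 4) * (1 - ε / 4)) * ((V : ℝ) * V) :=
    mul_le_mul_of_nonneg_right (by linarith [mul_self_nonneg (ε / 4)]) (mul_nonneg hV0 hV0)
  have h8 : 0 ≤ (1 - ε) * (V : ℝ) := mul_nonneg (by linarith) hV0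
  rw [Nat.choose_two_right, Nat.le_div_iff_mul_le (by norm_num)]
  have h9 : (E : ℝ) * 2 ≤ ((V - 2 * n - 2 : ℕ) : ℝ) * ((V - 2 * n - 2 - 1 : ℕ) : ℝ) := by
    rw [h1, h2]
    linarith
  exact_mod_cast h9

/-- The choice of parameters: for each of the two kinds of graphs, the counting bounds in the form
needed for the lower bound on the depth. -/
theorem exists_counting_bound {ε : ℝ} (hε : 0 < ε) (hε1 : ε < 1) :
    ∃ α β : ℝ, 0 < α ∧ 0 < β ∧ β ≤ 1 ∧ ∃ V₀ : ℕ, ∀ V E M B : ℕ, V₀ ≤ V → V ≤ E →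
      (E : ℝ) ≤ (1 - ε) * ((V : ℝ) * ((V : ℝ) - 1) / 2) → 1 ≤ B →
      ∀ {γ : Type} {Ans : SimpleGraph (Fin V) → γ → Prop} (_ : IsMinCutAnswer Ans)
        (T : IOTree V M B γ) (_ : ∀ (G : SimpleGraph (Fin V)) (e : Fin E → Fin V × Fin V),
          G.Connected → IsEdgeList G e → Ans G (T.run (initialState M B e))),
      ∃ N n : ℕ, α * E ≤ N ∧ β * V ≤ n ∧
        ((n : ℝ) / 3) ^ N ≤ (V : ℝ) ^ 6 *
          (((V + 1) * (4 * M + 2 * B).choose (2 * B) : ℕ) : ℝ) ^ T.depth *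
            ((5 * B : ℕ) : ℝ) ^ N ∧
        ((n : ℝ) / 3) ^ N ≤ (V : ℝ) ^ 6 *
          (((V + 1) * ((4 * M + 2 * B).choose (2 * B) * (5 * B) ^ B) : ℕ) : ℝ) ^ T.depth := by
  obtain ⟨k, hk⟩ := exists_nat_ge (16 / ε)
  have hk16 : (16 : ℝ) ≤ k := le_trans (by rw [le_div_iff₀ hε]; linarith) hk
  have hk16' : 16 ≤ k := by exact_mod_cast hk16
  have hk0 : (0 : ℝ) < k := by linarith
  have hkε : 16 ≤ k * ε := by rwa [div_le_iff₀ hε] at hk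
  refine ⟨1 / (8 * k), 1 / (2 * k), by positivity, by positivity, ?_, 8 * k, ?_⟩
  · rw [div_le_iff₀ (by positivity)]
    linarith
  intro V E M B hV hVE hE hB γ Ans hAns T hT
  have hV' : (8 : ℝ) * k ≤ V := by exact_mod_cast hV
  have hV0 : (0 : ℝ) < V := by linarith
  have hV1 : 1 ≤ V := by omega
  by_cases hE3 : E < 3 * V
  · -- few edges: Hamiltonian cycles with `V / 8` unknown edges
    set n := V / 8 with hn
    have hn2 : 2 ≤ n := by omega
    have hVn : V < 8 * n + 8 := by omega
    have hE2 : E ≤ n + (V - 4 * n).choose 2 := by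
      have h3 : 6 * V ≤ (V - 4 * n) * (V - 4 * n - 1) := by
        have h4 : V ≤ 2 * (V - 4 * n) := by omega
        have h5 : 12 ≤ V - 4 * n - 1 := by omega
        nlinarith
      have h6 : 3 * V ≤ (V - 4 * n).choose 2 := by
        rw [Nat.choose_two_right, Nat.le_div_iff_mul_le (by norm_num)]
        omega
      omega
    obtain ⟨h1, h2⟩ := card_le_of_hamCycle (n := n) (ℓ := V - 4 * n) hAns (by omega) (by omega) hn2
      hVE hE2 hB T hT
    have hfac : ((n : ℝ) / 3) ^ n ≤ (V : ℝ) ^ 6 * ((n - 1).factorial : ℝ) := by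
      refine (div_three_pow_le_factorial n).trans ?_
      rw [← Nat.mul_factorial_pred (by omega : n ≠ 0)]
      have h3 : n ≤ V ^ 6 := (by omega : n ≤ V).trans (Nat.le_self_pow (by norm_num) V)
      exact_mod_cast Nat.mul_le_mul_right _ h3
    have hnV : (V : ℝ) ≤ 16 * n := by
      have : V ≤ 16 * n := by omega
      exact_mod_cast this
    refine ⟨n, n, ?_, ?_, ?_, ?_⟩
    · have hE3' : (E : ℝ) ≤ 3 * V := by exact_mod_cast hE3.le
      rw [div_mul_eq_mul_div, one_mul, div_le_iff₀ (by positivity)]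
      nlinarith
    · rw [div_mul_eq_mul_div, one_mul, div_le_iff₀ (by positivity)]
      nlinarith
    · refine hfac.trans ?_
      rw [mul_assoc]
      refine mul_le_mul_of_nonneg_left ?_ (by positivity)
      exact_mod_cast h1
    · refine hfac.trans (mul_le_mul_of_nonneg_left ?_ (by positivity))
      exact_mod_cast h2
  · -- many edges: two components and a bridge
    set n := V / k with hn
    have hnk : n * k ≤ V := Nat.div_mul_le_self V k
    have hVn : V < n * k + k := by
      have := Nat.lt_div_mul_add (a := V) (b := k) (by omega)
      omega
    have hn8 : 8 ≤ n := (Nat.le_div_iff_mul_le (by omega)).2 hV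
    have h16n : 16 * n ≤ V := le_trans (by rw [mul_comm]; exact Nat.mul_le_mul_left n hk16') hnk
    set ℓ := V - 2 * n - 2 with hℓ
    set d := E / (4 * k * V) + 1 with hd
    have hVℓ : V ≤ 2 * ℓ := by omega
    have hE3' : (3 : ℝ) * V ≤ E := by exact_mod_cast not_lt.1 hE3
    have hEV : (2 : ℝ) * E ≤ V * V := by nlinarith
    have hEV' : 2 * E ≤ V * V := by exact_mod_cast hEV
    have hdn : 2 * d ≤ n := by
      have h1 : E / (4 * k * V) ≤ V / (8 * k) := by
        rw [Nat.le_div_iff_mul_le (by omega)]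
        have h2 := Nat.div_mul_le_self E (4 * k * V)
        set e := E / (4 * k * V)
        have h3 : e * (8 * k) * V ≤ V * V := by nlinarith
        exact Nat.le_of_mul_le_mul_right h3 hV1
      have h2 : V / (8 * k) = n / 8 := by rw [hn, Nat.div_div_eq_div_mul, mul_comm]
      omega
    have hNE : ℓ * d * 64 ≤ E + 64 * V := by
      have h1 := Nat.div_mul_le_self E (4 * k * V)
      set e := E / (4 * k * V)
      have h2 : V * e * 64 ≤ E := by
        calc V * e * 64 ≤ V * e * (4 * k) := Nat.mul_le_mul_left _ (by omega)
          _ = e * (4 * k * V) := by ring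
          _ ≤ E := h1
      have h3 : ℓ * d ≤ V * d := Nat.mul_le_mul_right d (by omega)
      calc ℓ * d * 64 ≤ V * d * 64 := Nat.mul_le_mul_right _ h3
        _ = V * e * 64 + 64 * V := by rw [hd]; ring
        _ ≤ _ := by omega
    have hchoose : E ≤ ℓ.choose 2 := le_choose_two hε hε1 hkε hV' hnk h16n hE
    have hN1 : 1 ≤ ℓ * d := Nat.mul_pos (by omega) (Nat.succ_pos _)
    obtain ⟨h1, h2⟩ := card_le_of_bridge (V := V) (n := n) (ℓ := ℓ) (d := d) hAns (by omega)
      (by omega) hN1 (by omega) (by omega) hB T hT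
    have hleft : ((n : ℝ) / 3) ^ (ℓ * d) ≤ ((n.descFactorial d ^ ℓ : ℕ) : ℝ) := by
      have h3 : (n : ℝ) / 3 ≤ ((n + 1 - d : ℕ) : ℝ) := by
        have h4 : n ≤ 3 * (n + 1 - d) := by omega
        have h5 : (n : ℝ) ≤ 3 * ((n + 1 - d : ℕ) : ℝ) := by exact_mod_cast h4
        linarith
      rw [mul_comm ℓ d, pow_mul, Nat.cast_pow]
      refine pow_le_pow_left₀ (by positivity) ?_ ℓ
      refine (pow_le_pow_left₀ (by positivity) h3 d).trans ?_
      exact_mod_cast Nat.pow_sub_le_descFactorial n d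
    have hq : ((ℓ * d * V) ^ 2 : ℕ) ≤ V ^ 6 := by
      have h3 : ℓ * d * V ≤ V * V * V :=
        Nat.mul_le_mul_right V (Nat.mul_le_mul (by omega) (by omega))
      calc (ℓ * d * V) ^ 2 ≤ (V * V * V) ^ 2 := Nat.pow_le_pow_left h3 2
        _ = V ^ 6 := by ring
    refine ⟨ℓ * d, n, ?_, ?_, hleft.trans ?_, hleft.trans ?_⟩
    · have h3 : E < d * (4 * k * V) := by
        have := Nat.lt_div_mul_add (a := E) (b := 4 * k * V) (by positivity)
        rw [hd, add_mul, one_mul]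
        omega
      have h4 : E ≤ ℓ * d * (8 * k) := by
        calc E ≤ d * (4 * k * V) := h3.le
          _ ≤ d * (4 * k * (2 * ℓ)) := by gcongr
          _ = _ := by ring
      rw [div_mul_eq_mul_div, one_mul, div_le_iff₀ (by positivity)]
      exact_mod_cast h4
    · have h3 : V ≤ n * (2 * k) := by nlinarith
      rw [div_mul_eq_mul_div, one_mul, div_le_iff₀ (by positivity)]
      exact_mod_cast h3
    · have h3 := h1.trans (Nat.mul_le_mul_right _ (Nat.mul_le_mul_right _ hq))
      exact_mod_cast h3
    · have h3 := h2.trans (Nat.mul_le_mul_right _ hq)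
      exact_mod_cast h3

theorem mainTheorem4 :
    ∀ ε : ℝ, 0 < ε → ∃ c : ℝ, 0 < c ∧ ∃ V₀ : ℕ, ∀ V E M B : ℕ,
      V₀ ≤ V → V ≤ E → (E : ℝ) ≤ (1 - ε) * ((V : ℝ) * ((V : ℝ) - 1) / 2) →
      1 ≤ B → 2 * B ≤ M →
      Real.log V < (B : ℝ) * Real.log ((M : ℝ) / B) →
      (∀ T : IOTree V M B ℕ, ComputesMinCutValue E T →
        c * ((E : ℝ) / V * sortBound M B V) ≤ (T.depth : ℝ)) ∧
      (∀ T : IOTree V M B (Finset (Fin V)), ComputesMinCut E T →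
        c * ((E : ℝ) / V * sortBound M B V) ≤ (T.depth : ℝ)) := by
  intro ε hε
  rcases lt_or_ge ε 1 with hε1 | hε1
  · obtain ⟨α, β, hα, hβ, hβ1, V₁, h1⟩ := exists_counting_bound hε hε1
    obtain ⟨c, hc, V₂, h2⟩ := exists_depth_bound α β hα hβ hβ1
    refine ⟨c, hc, max V₁ V₂, fun V E M B hV hVE hE hB hM hlog => ⟨fun T hT => ?_, fun T hT => ?_⟩⟩
    · obtain ⟨N, n, h3, h4, h5, h6⟩ := h1 V E M B ((le_max_left _ _).trans hV) hVE hE hB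
        isMinCutAnswer_value T hT
      exact h2 V E M B N n _ ((le_max_right _ _).trans hV) hVE hB hM hlog h3 h4 h5 h6
    · obtain ⟨N, n, h3, h4, h5, h6⟩ := h1 V E M B ((le_max_left _ _).trans hV) hVE hE hB
        isMinCutAnswer_cut T hT
      exact h2 V E M B N n _ ((le_max_right _ _).trans hV) hVE hB hM hlog h3 h4 h5 h6
  · -- for `ε ≥ 1` no graph has so few edges
    refine ⟨1, one_pos, 1, fun V E M B hV hVE hE => ?_⟩
    have hV' : (1 : ℝ) ≤ V := by exact_mod_cast hV
    have hVE' : (V : ℝ) ≤ E := by exact_mod_cast hVE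
    have : (1 - ε) * ((V : ℝ) * ((V : ℝ) - 1) / 2) ≤ 0 :=
      mul_nonpos_of_nonpos_of_nonneg (by linarith)
        (div_nonneg (mul_nonneg (by linarith) (by linarith)) (by norm_num))
    linarith
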